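/- For a group $G$ write $(a,b)=a^{-1}b^{-1}ab$, let $\gamma_1(G)=G$, $\gamma_{c+1}(G)=(\gamma_c(G),G)$ be the lower central series, $\mathrm{gr}_c(G)=\gamma_c(G)/\gamma_{c+1}(G)$, and let $\mathrm{gr}(G)=\bigoplus_{c\ge 1}\mathrm{gr}_c(G)$ be the associated graded Lie algebra over $\mathbb{Z}$, with bracket $[a\gamma_{c+1}(G),b\gamma_{d+1}(G)]=(a,b)\gamma_{c+d+1}(G)$ for $a\in\gamma_c(G)$, $b\in\gamma_d(G)$. Let $n\ge 2$ and let $F_n$ be the free group of rank $n$. For $r\ge 2$ let $\mathrm{I}_r\mathrm{A}(F_n)$ be the kernel of the natural homomorphism $\mathrm{Aut}(F_n)\to\mathrm{Aut}(F_n/\gamma_r(F_n))$, let $\mathrm{IA}(F_n)=\mathrm{I}_2\mathrm{A}(F_n)$ and $\mathcal{L}^r(\mathrm{IA}(F_n))=\mathrm{I}_r\mathrm{A}(F_n)/\mathrm{I}_{r+1}\mathrm{A}(F_n)$. The Johnson Lie algebra is $\mathcal{L}(\mathrm{IA}(F_n))=\bigoplus_{r\ge 2}\mathcal{L}^r(\mathrm{IA}(F_n))$,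 a Lie algebra over $\mathbb{Z}$ with $[\phi\,\mathrm{I}_{j+1}\mathrm{A}(F_n),\psi\,\mathrm{I}_{k+1}\mathrm{A}(F_n)]=(\phi,\psi)\,\mathrm{I}_{j+k}\mathrm{A}(F_n)$ for $\phi\in\mathrm{I}_j\mathrm{A}(F_n)$, $\psi\in\mathrm{I}_k\mathrm{A}(F_n)$. For a subgroup $H$ of $\mathrm{IA}(F_n)$ let $\mathcal{L}_1(H)=\bigoplus_{q\ge 1}\gamma_q(H)\,\mathrm{I}_{q+2}\mathrm{A}(F_n)/\mathrm{I}_{q+2}\mathrm{A}(F_n)$, a Lie subalgebra of $\mathcal{L}(\mathrm{IA}(F_n))$. If $H$ is finitely generated and $H/H'$ is torsion-free, $\mathrm{gr}(H)$ is said to be naturally embedded into $\mathcal{L}(\mathrm{IA}(F_n))$ if there is an isomorphism of Lie algebras $\varphi$ from $\mathrm{gr}(H)$ onto $\mathcal{L}_1(H)$ with $\varphi(yH')=y\,\mathrm{I}_3\mathrm{A}(F_n)$ for all $y\in H$ (equivalently, for those $y$ in a set of representatives of a $\mathbb{Z}$-basis of $H/H'$). Proposition. Let $n\ge 2$ and let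 $\mathrm{Inn}(F_n)$ be the group of inner automorphisms of $F_n$. Then $\mathrm{Inn}(F_n)$ is a finitely generated subgroup of $\mathrm{IA}(F_n)$ with torsion-free abelianization, and $\mathrm{gr}(\mathrm{Inn}(F_n))$ is naturally embedded into $\mathcal{L}(\mathrm{IA}(F_n))$. In particular, for every $c\ge 1$, $\mathrm{gr}_c(\mathrm{Inn}(F_n))$ is isomorphic to a $\mathbb{Z}$-submodule of $\mathcal{L}^{c+1}(\mathrm{IA}(F_n))$. -/

import Mathlib

namespace JohnsonLie

open DirectSum
open scoped commutatorElement

/-! ### The graded Lie ring of a strongly central filtration -/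

/-- A descending sequence `N₁ ≥ N₂ ≥ ⋯` of subgroups of `G` with `(Nᵢ, Nⱼ) ≤ Nᵢ₊ⱼ`. -/
structure NSeries (G : Type*) [Group G] where
  /-- The `i`-th term of the sequence. -/
  sub : ℕ+ → Subgroup G
  succ_le : ∀ i, sub (i + 1) ≤ sub i
  commutator_le : ∀ i j, ⁅sub i, sub j⁆ ≤ sub (i + j)

/-- The group commutator `(a, b) = a⁻¹ b⁻¹ a b`. -/
def comm {G : Type*} [Group G] (a b : G) : G := a⁻¹ * b⁻¹ * a * b

namespace NSeries

variable {G : Type*} [Group G] (N : NSeries G)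

theorem antitone {i j : ℕ+} (h : i ≤ j) : N.sub j ≤ N.sub i := by
  induction j using PNat.recOn with
  | one =>
    have : i = 1 := le_antisymm h one_le
    rw [this]
  | succ j ih =>
    rcases eq_or_lt_of_le h with h | h
    · rw [h]
    · exact (N.succ_le j).trans (ih (PNat.lt_add_one_iff.mp h))

theorem comm_mem {i j : ℕ+} {a b : G} (ha : a ∈ N.sub i) (hb : b ∈ N.sub j) :
    comm a b ∈ N.sub (i + j) := by
  have h := N.commutator_le i j (Subgroup.commutator_mem_commutator
    ((N.sub i).inv_mem ha) ((N.sub j).inv_mem hb))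
  simpa [comm, commutatorElement_def] using h

theorem comm_mem_of_le {i j k : ℕ+} {a b : G} (ha : a ∈ N.sub i) (hb : b ∈ N.sub j)
    (h : k ≤ i + j) : comm a b ∈ N.sub k := N.antitone h (N.comm_mem ha hb)

theorem conj_mem {i j : ℕ+} {a b : G} (ha : a ∈ N.sub i) (hb : b ∈ N.sub j) :
    b⁻¹ * a * b ∈ N.sub i := by
  have h : b⁻¹ * a * b = a * comm a b := by simp [comm, mul_assoc]
  rw [h]
  exact mul_mem ha (N.comm_mem_of_le ha hb (PNat.lt_add_right i j).le)

instance normal_succ (i : ℕ+) : ((N.sub (i + 1)).subgroupOf (N.sub i)).Normal := by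
  refine ⟨fun a ha g => ?_⟩
  rw [Subgroup.mem_subgroupOf] at ha ⊢
  simpa using N.conj_mem ha ((N.sub i).inv_mem g.2)

theorem mk_eq_of {i : ℕ+} {a b : N.sub i} (h : (a : G)⁻¹ * b ∈ N.sub (i + 1)) :
    (QuotientGroup.mk a : N.sub i ⧸ (N.sub (i + 1)).subgroupOf (N.sub i)) = QuotientGroup.mk b :=
  QuotientGroup.eq.mpr (by simpa [Subgroup.mem_subgroupOf] using h)

/-- The homogeneous component `Nᵢ / Nᵢ₊₁` of degree `i`, written additively. -/
def Comp (i : ℕ+) : Type _ := Additive (N.sub i ⧸ (N.sub (i + 1)).subgroupOf (N.sub i))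

theorem quotient_mul_comm (i : ℕ+) (x y : N.sub i ⧸ (N.sub (i + 1)).subgroupOf (N.sub i)) :
    x * y = y * x := by
  obtain ⟨a, rfl⟩ := QuotientGroup.mk_surjective x
  obtain ⟨b, rfl⟩ := QuotientGroup.mk_surjective y
  rw [← QuotientGroup.mk_mul, ← QuotientGroup.mk_mul]
  apply N.mk_eq_of
  have h : ((a * b : N.sub i) : G)⁻¹ * ((b * a : N.sub i) : G) = comm (b : G) (a : G) := by
    simp [comm, mul_assoc]
  rw [h]
  exact N.comm_mem_of_le b.2 a.2 (add_le_add_right one_le i)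

instance quotientCommGroup (i : ℕ+) :
    CommGroup (N.sub i ⧸ (N.sub (i + 1)).subgroupOf (N.sub i)) where
  mul_comm := N.quotient_mul_comm i

instance (i : ℕ+) : AddCommGroup (N.Comp i) :=
  inferInstanceAs (AddCommGroup (Additive (N.sub i ⧸ (N.sub (i + 1)).subgroupOf (N.sub i))))

/-- The projection `Nᵢ → Nᵢ / Nᵢ₊₁`. -/
def proj (i : ℕ+) : Additive (N.sub i) →+ N.Comp i :=
  MonoidHom.toAdditive (QuotientGroup.mk' ((N.sub (i + 1)).subgroupOf (N.sub i)))

/-- The class `a Nᵢ₊₁` of an element `a` of `Nᵢ`. -/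
def cl (i : ℕ+) (a : N.sub i) : N.Comp i := N.proj i (Additive.ofMul a)

theorem cl_surjective (i : ℕ+) : Function.Surjective (N.cl i) := fun x =>
  QuotientGroup.mk_surjective (s := (N.sub (i + 1)).subgroupOf (N.sub i)) x.toMul

theorem cl_mul (i : ℕ+) (a b : N.sub i) : N.cl i (a * b) = N.cl i a + N.cl i b := rfl

theorem cl_one (i : ℕ+) : N.cl i 1 = 0 := rfl

theorem cl_eq_iff {i : ℕ+} {a b : N.sub i} :
    N.cl i a = N.cl i b ↔ (a : G)⁻¹ * b ∈ N.sub (i + 1) :=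
  (QuotientGroup.eq (s := (N.sub (i + 1)).subgroupOf (N.sub i))).trans
    (by simp [Subgroup.mem_subgroupOf])

/-- The commutator of elements of `Nᵢ` and `Nⱼ`, as an element of `Nᵢ₊ⱼ`. -/
def commEl {i j : ℕ+} (a : N.sub i) (b : N.sub j) : N.sub (i + j) :=
  ⟨comm (a : G) (b : G), N.comm_mem a.2 b.2⟩

theorem cl_commEl_mul_left {i j : ℕ+} (a a' : N.sub i) (b : N.sub j) :
    N.cl (i + j) (N.commEl (a * a') b) =
      N.cl (i + j) (N.commEl a b) + N.cl (i + j) (N.commEl a' b) := by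
  rw [← cl_mul, eq_comm, cl_eq_iff]
  have h : (↑(N.commEl a b * N.commEl a' b) : G)⁻¹ * ↑(N.commEl (a * a') b) =
      (comm (a' : G) b)⁻¹ * comm (comm (a : G) b) (a' : G) * comm (a' : G) b := by
    simp [commEl, comm, mul_assoc]
  rw [h]
  refine N.conj_mem (j := i + j) (N.comm_mem_of_le (N.comm_mem a.2 b.2) a'.2 ?_)
    (N.comm_mem a'.2 b.2)
  exact add_le_add_right one_le (i + j)

theorem cl_commEl_mul_right {i j : ℕ+} (a : N.sub i) (b b' : N.sub j) :
    N.cl (i + j) (N.commEl a (b * b')) =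
      N.cl (i + j) (N.commEl a b) + N.cl (i + j) (N.commEl a b') := by
  rw [add_comm (N.cl (i + j) _), ← cl_mul, eq_comm, cl_eq_iff]
  have h : (↑(N.commEl a b' * N.commEl a b) : G)⁻¹ * ↑(N.commEl a (b * b')) =
      comm (comm (a : G) b) (b' : G) := by
    simp [commEl, comm, mul_assoc]
  rw [h]
  exact N.comm_mem_of_le (N.comm_mem a.2 b.2) b'.2 (add_le_add_right one_le (i + j))

theorem cl_commEl_of_mem_left {i j : ℕ+} {a : N.sub i} (b : N.sub j)
    (h : (a : G) ∈ N.sub (i + 1)) : N.cl (i + j) (N.commEl a b) = 0 := by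
  rw [← cl_one, eq_comm, cl_eq_iff]
  have h' := N.comm_mem h b.2
  rw [add_right_comm] at h'
  simpa [commEl] using h'

theorem cl_commEl_of_mem_right {i j : ℕ+} (a : N.sub i) {b : N.sub j}
    (h : (b : G) ∈ N.sub (j + 1)) : N.cl (i + j) (N.commEl a b) = 0 := by
  rw [← cl_one, eq_comm, cl_eq_iff]
  have h' := N.comm_mem a.2 h
  rw [← add_assoc] at h'
  simpa [commEl] using h'

theorem cl_commEl_congr {i j : ℕ+} {a a' : N.sub i} {b b' : N.sub j}
    (ha : N.cl i a = N.cl i a') (hb : N.cl j b = N.cl j b') :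
    N.cl (i + j) (N.commEl a b) = N.cl (i + j) (N.commEl a' b') := by
  rw [cl_eq_iff] at ha hb
  have h1 : a' = a * (a⁻¹ * a') := by group
  have h2 : b' = b * (b⁻¹ * b') := by group
  rw [h1, h2, cl_commEl_mul_left, N.cl_commEl_of_mem_left (a := a⁻¹ * a') _ (by simpa using ha),
    cl_commEl_mul_right, N.cl_commEl_of_mem_right a (b := b⁻¹ * b') (by simpa using hb)]
  simp

/-- The bracket of homogeneous elements, `[a Nᵢ₊₁, b Nⱼ₊₁] = (a, b) Nᵢ₊ⱼ₊₁`. -/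
def compBracketFun {i j : ℕ+} (x : N.Comp i) (y : N.Comp j) : N.Comp (i + j) :=
  Quotient.liftOn₂ (s₁ := QuotientGroup.leftRel ((N.sub (i + 1)).subgroupOf (N.sub i)))
    (s₂ := QuotientGroup.leftRel ((N.sub (j + 1)).subgroupOf (N.sub j)))
    x y (fun a b => N.cl (i + j) (N.commEl a b))
    (fun _ _ _ _ ha hb => N.cl_commEl_congr
      (Quotient.sound (s := QuotientGroup.leftRel ((N.sub (i + 1)).subgroupOf (N.sub i))) ha)
      (Quotient.sound (s := QuotientGroup.leftRel ((N.sub (j + 1)).subgroupOf (N.sub j))) hb))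

theorem compBracketFun_cl {i j : ℕ+} (a : N.sub i) (b : N.sub j) :
    N.compBracketFun (N.cl i a) (N.cl j b) = N.cl (i + j) (N.commEl a b) := rfl

/-- The bracket of homogeneous elements as a biadditive map. -/
def compBracket (i j : ℕ+) : N.Comp i →+ N.Comp j →+ N.Comp (i + j) :=
  AddMonoidHom.mk' (fun x => AddMonoidHom.mk' (fun y => N.compBracketFun x y) (by
      intro y y'
      obtain ⟨a, rfl⟩ := N.cl_surjective i x
      obtain ⟨b, rfl⟩ := N.cl_surjective j y
      obtain ⟨b', rfl⟩ := N.cl_surjective j y'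
      rw [← cl_mul]
      exact N.cl_commEl_mul_right a b b')) (by
    intro x x'
    ext y
    obtain ⟨a, rfl⟩ := N.cl_surjective i x
    obtain ⟨a', rfl⟩ := N.cl_surjective i x'
    obtain ⟨b, rfl⟩ := N.cl_surjective j y
    rw [← cl_mul]
    exact N.cl_commEl_mul_left a a' b)

theorem compBracket_cl {i j : ℕ+} (a : N.sub i) (b : N.sub j) :
    N.compBracket i j (N.cl i a) (N.cl j b) = N.cl (i + j) (N.commEl a b) := rfl

/-- The direct sum `⨁ᵢ Nᵢ / Nᵢ₊₁` over all `i ≥ 1`. -/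
def Gr : Type _ := ⨁ i : ℕ+, N.Comp i

noncomputable instance : AddCommGroup N.Gr :=
  inferInstanceAs (AddCommGroup (⨁ i : ℕ+, N.Comp i))

/-- The component of degree `i` of an element of the direct sum. -/
noncomputable def coeff (i : ℕ+) : N.Gr →+ N.Comp i :=
  (Pi.evalAddMonoidHom (fun i => N.Comp i) i).comp
    (DirectSum.coeFnAddMonoidHom (fun i => N.Comp i))

/-- The inclusion of the component of degree `i` into the direct sum. -/
noncomputable def incl (i : ℕ+) : N.Comp i →+ N.Gr := DirectSum.of (fun i => N.Comp i) i

theorem coeff_incl_same (i : ℕ+) (x : N.Comp i) : N.coeff i (N.incl i x) = x :=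
  DirectSum.of_eq_same i x

theorem coeff_incl_of_ne {i j : ℕ+} (h : j ≠ i) (x : N.Comp i) : N.coeff j (N.incl i x) = 0 :=
  DirectSum.of_eq_of_ne i j x h

theorem Gr.induction {p : N.Gr → Prop} (h0 : p 0)
    (h1 : ∀ (i : ℕ+) (a : N.sub i), p (N.incl i (N.cl i a)))
    (h2 : ∀ x y, p x → p y → p (x + y)) (x : N.Gr) : p x := by
  refine DirectSum.induction_on x h0 (fun i y => ?_) h2
  obtain ⟨a, rfl⟩ := N.cl_surjective i y
  exact h1 i a

/-- The additive map on the direct sum given by additive maps on the components. -/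
noncomputable def Gr.lift {M : Type*} [AddCommMonoid M] (f : ∀ i, N.Comp i →+ M) : N.Gr →+ M :=
  DirectSum.toAddMonoid f

theorem Gr.lift_incl {M : Type*} [AddCommMonoid M] (f : ∀ i, N.Comp i →+ M) (i : ℕ+)
    (x : N.Comp i) : Gr.lift N f (N.incl i x) = f i x := DirectSum.toAddMonoid_of f i x

theorem incl_cl_congr {i j : ℕ+} (h : i = j) {a : N.sub i} {b : N.sub j}
    (hab : (a : G)⁻¹ * b ∈ N.sub (i + 1)) : N.incl i (N.cl i a) = N.incl j (N.cl j b) := by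
  subst h
  rw [N.cl_eq_iff.mpr hab]

/-- The biadditive extension to the direct sum of the bracket of homogeneous elements. -/
noncomputable def bracketHom : N.Gr →+ N.Gr →+ N.Gr :=
  Gr.lift N fun i => AddMonoidHom.flip <| Gr.lift N fun j =>
    AddMonoidHom.flip ((AddMonoidHom.compHom (N.incl (i + j))).comp (N.compBracket i j))

theorem bracketHom_incl (i j : ℕ+) (x : N.Comp i) (y : N.Comp j) :
    N.bracketHom (N.incl i x) (N.incl j y) = N.incl (i + j) (N.compBracket i j x y) := by
  rw [bracketHom, Gr.lift_incl, AddMonoidHom.flip_apply, Gr.lift_incl]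
  rfl

theorem bracketHom_cl {i j : ℕ+} (a : N.sub i) (b : N.sub j) :
    N.bracketHom (N.incl i (N.cl i a)) (N.incl j (N.cl j b)) =
      N.incl (i + j) (N.cl (i + j) (N.commEl a b)) := by
  rw [bracketHom_incl, compBracket_cl]

theorem bracketHom_skew (x y : N.Gr) : N.bracketHom x y + N.bracketHom y x = 0 := by
  revert x
  refine Gr.induction N (by simp) (fun i a => ?_) (fun x x' h h' => ?_)
  · revert y
    refine Gr.induction N (by simp) (fun j b => ?_) (fun y y' h h' => ?_)
    · rw [bracketHom_cl, bracketHom_cl,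
        N.incl_cl_congr (add_comm j i) (b := (N.commEl a b)⁻¹) ?_, ← map_add, ← cl_mul]
      · simp [cl_one]
      · have : ((N.commEl b a : N.sub (j + i)) : G)⁻¹ * (((N.commEl a b)⁻¹ : N.sub (i + j)) : G)
            = 1 := by simp [commEl, comm, mul_assoc]
        rw [this]
        exact one_mem _
    · simp only [map_add, AddMonoidHom.add_apply]
      rw [add_add_add_comm, h, h', add_zero]
  · simp only [map_add, AddMonoidHom.add_apply]
    rw [add_add_add_comm, h, h', add_zero]

theorem bracketHom_self (x : N.Gr) : N.bracketHom x x = 0 := by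
  revert x
  refine Gr.induction N (by simp) (fun i a => ?_) (fun x y h h' => ?_)
  · rw [bracketHom_cl]
    have : N.commEl a a = 1 := Subtype.ext (by simp [commEl, comm, mul_assoc])
    rw [this, cl_one, map_zero]
  · simp only [map_add, AddMonoidHom.add_apply]
    rw [h, h', zero_add, add_zero, add_comm, N.bracketHom_skew]

theorem conj_incl_cl {i j : ℕ+} (a : N.sub i) (b : N.sub j) :
    N.incl i (N.cl i ⟨(b : G)⁻¹ * a * b, N.conj_mem a.2 b.2⟩) = N.incl i (N.cl i a) := by
  refine (N.incl_cl_congr rfl ?_).symm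
  have : (a : G)⁻¹ * ((b : G)⁻¹ * a * b) = comm (a : G) b := by simp [comm, mul_assoc]
  rw [this]
  exact N.comm_mem_of_le a.2 b.2 (add_le_add_right one_le i)

theorem bracketHom_conj {i j k : ℕ+} (a : N.sub i) (b : N.sub j) (c : N.sub k) :
    N.bracketHom (N.incl j (N.cl j b))
      (N.bracketHom (N.incl i (N.cl i a)) (N.incl k (N.cl k c))) =
    N.incl (j + (i + k)) (N.cl (j + (i + k))
      (N.commEl ⟨(a : G)⁻¹ * b * a, N.conj_mem b.2 a.2⟩ (N.commEl a c))) := by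
  rw [← N.conj_incl_cl b a, bracketHom_cl, bracketHom_cl]

theorem bracketHom_jacobi (x y z : N.Gr) :
    N.bracketHom y (N.bracketHom x z) + N.bracketHom x (N.bracketHom z y) +
      N.bracketHom z (N.bracketHom y x) = 0 := by
  revert x
  refine Gr.induction N (by simp) (fun i a => ?_) (fun x x' h h' => ?_)
  · revert y
    refine Gr.induction N (by simp) (fun j b => ?_) (fun y y' h h' => ?_)
    · revert z
      refine Gr.induction N (by simp) (fun k c => ?_) (fun z z' h h' => ?_)
      · rw [bracketHom_conj, bracketHom_conj, bracketHom_conj]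
        have e1 : i + (k + j) = j + (i + k) := by rw [add_left_comm j, add_comm j]
        have e2 : k + (j + i) = j + (i + k) := by rw [add_comm i, add_left_comm j]
        set u : N.sub (j + (i + k)) :=
          N.commEl ⟨(a : G)⁻¹ * b * a, N.conj_mem b.2 a.2⟩ (N.commEl a c) with hu
        set v := N.commEl (⟨(c : G)⁻¹ * a * c, N.conj_mem a.2 c.2⟩ : N.sub i) (N.commEl c b)
          with hv
        set w := N.commEl (⟨(b : G)⁻¹ * c * b, N.conj_mem c.2 b.2⟩ : N.sub k) (N.commEl b a)
          with hw
        rw [N.incl_cl_congr e1 (a := v) (b := ⟨v, e1 ▸ v.2⟩) (by simp),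
          N.incl_cl_congr e2 (a := w) (b := ⟨w, e2 ▸ w.2⟩) (by simp),
          ← map_add, ← map_add, ← cl_mul, ← cl_mul]
        have : u * ⟨v, e1 ▸ v.2⟩ * ⟨w, e2 ▸ w.2⟩ = 1 := by
          apply Subtype.ext
          simp [hu, hv, hw, commEl, comm, mul_assoc]
        rw [this, cl_one, map_zero]
      · simp only [map_add, AddMonoidHom.add_apply] at h h' ⊢
        rw [← add_zero (0 : N.Gr)]
        nth_rewrite 1 [← h]
        rw [← h']
        abel
    · simp only [map_add, AddMonoidHom.add_apply] at h h' ⊢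
      rw [← add_zero (0 : N.Gr)]
      nth_rewrite 1 [← h]
      rw [← h']
      abel
  · simp only [map_add, AddMonoidHom.add_apply] at h h' ⊢
    rw [← add_zero (0 : N.Gr)]
    nth_rewrite 1 [← h]
    rw [← h']
    abel

/-- The Lie ring `⨁ᵢ Nᵢ / Nᵢ₊₁`; its structure of Lie algebra over `ℤ` is the usual one
of a Lie ring. -/
noncomputable instance : LieRing N.Gr where
  bracket x y := N.bracketHom x y
  add_lie x y z := by simp
  lie_add x y z := by simp
  lie_self x := N.bracketHom_self x
  leibniz_lie x y z := by
    change N.bracketHom x (N.bracketHom y z) = N.bracketHom (N.bracketHom x y) z +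
      N.bracketHom y (N.bracketHom x z)
    have h1 := N.bracketHom_jacobi x y z
    have h2 := N.bracketHom_skew (N.bracketHom x y) z
    have h3 : N.bracketHom y z = - N.bracketHom z y :=
      eq_neg_of_add_eq_zero_left (N.bracketHom_skew y z)
    have h4 : N.bracketHom y x = - N.bracketHom x y :=
      eq_neg_of_add_eq_zero_left (N.bracketHom_skew y x)
    rw [h4, map_neg] at h1
    rw [h3, map_neg, eq_neg_of_add_eq_zero_left h2]
    rw [← sub_eq_zero, ← neg_eq_zero, ← h1]
    abel

theorem lie_cl {i j : ℕ+} (a : N.sub i) (b : N.sub j) :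
    ⁅N.incl i (N.cl i a), N.incl j (N.cl j b)⁆ =
      N.incl (i + j) (N.cl (i + j) (N.commEl a b)) := N.bracketHom_cl a b

end NSeries

/-! ### The lower central series and `gr` -/

section LowerCentral

variable {G : Type*} [Group G]

/-- The term `γ_c(S)`, `c ≥ 1`, of the lower central series of a (sub)group, with `γ₁(S) = S`. -/
def gamma (S : Subgroup G) (c : ℕ+) : Subgroup G := S.lowerCentralSeries c.natPred

theorem gamma_one (S : Subgroup G) : gamma S 1 = S := rfl

theorem gamma_succ (S : Subgroup G) (c : ℕ+) : gamma S (c + 1) = ⁅gamma S c, S⁆ := by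
  have : (c + 1).natPred = c.natPred + 1 := by
    rw [PNat.natPred_add_one, PNat.natPred, PNat.add_coe, PNat.one_coe, Nat.add_sub_cancel]
  rw [gamma, this]
  rfl

theorem gamma_succ_le (S : Subgroup G) (c : ℕ+) : gamma S (c + 1) ≤ gamma S c := by
  apply S.lowerCentralSeries_antitone
  simp [PNat.natPred]

instance gamma_characteristic (c : ℕ+) : (gamma (⊤ : Subgroup G) c).Characteristic := by
  unfold gamma
  infer_instance

/-- The three subgroups lemma modulo a normal subgroup. -/
theorem three_subgroups {A B C M : Subgroup G} [M.Normal] (h1 : ⁅⁅B, C⁆, A⁆ ≤ M)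
    (h2 : ⁅⁅C, A⁆, B⁆ ≤ M) : ⁅⁅A, B⁆, C⁆ ≤ M := by
  have key : ∀ X : Subgroup G, X ≤ M ↔ X.map (QuotientGroup.mk' M) = ⊥ := fun X => by
    rw [Subgroup.map_eq_bot_iff, QuotientGroup.ker_mk']
  rw [key] at h1 h2 ⊢
  simp only [Subgroup.map_commutator] at h1 h2 ⊢
  exact Subgroup.commutator_commutator_eq_bot_of_rotate h1 h2

theorem gamma_top_commutator_le (i j : ℕ+) :
    ⁅gamma (⊤ : Subgroup G) i, gamma (⊤ : Subgroup G) j⁆ ≤ gamma (⊤ : Subgroup G) (i + j) := by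
  induction j using PNat.recOn generalizing i with
  | one => rw [gamma_one, gamma_succ]
  | succ j ih =>
    rw [Subgroup.commutator_comm, gamma_succ]
    refine three_subgroups (M := gamma (⊤ : Subgroup G) (i + (j + 1))) ?_ ?_
    · rw [Subgroup.commutator_comm ⊤, ← gamma_succ]
      refine (ih (i + 1)).trans (le_of_eq ?_)
      rw [add_right_comm, add_assoc]
    · rw [← add_assoc, gamma_succ]
      exact Subgroup.commutator_mono (ih i) le_rfl

theorem map_subtype_gamma_top (S : Subgroup G) (c : ℕ+) :
    (gamma (⊤ : Subgroup S) c).map S.subtype = gamma S c :=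
  S.top_subtype_lowerCentralSeries c.natPred

theorem gamma_commutator_le (S : Subgroup G) (i j : ℕ+) :
    ⁅gamma S i, gamma S j⁆ ≤ gamma S (i + j) := by
  simp only [← map_subtype_gamma_top S]
  rw [← Subgroup.map_commutator]
  exact Subgroup.map_mono (gamma_top_commutator_le i j)

/-- The lower central series `γ₁(S) ≥ γ₂(S) ≥ ⋯`. -/
def lcs (S : Subgroup G) : NSeries G where
  sub := gamma S
  succ_le := gamma_succ_le S
  commutator_le := gamma_commutator_le S

/-- The `c`-th component `gr_c(S) = γ_c(S) / γ_{c+1}(S)`. -/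
abbrev grComp (S : Subgroup G) (c : ℕ+) : Type _ := (lcs S).Comp c

/-- The associated graded Lie algebra `gr(S) = ⨁_{c ≥ 1} γ_c(S) / γ_{c+1}(S)`. -/
abbrev gr (S : Subgroup G) : Type _ := (lcs S).Gr

end LowerCentral

/-! ### The groups `I_c A(G)` and the Johnson Lie algebra -/

section Johnson

variable (G : Type*) [Group G]

/-- The homomorphism `Aut(G) → Aut(G / K)` for a characteristic subgroup `K`. -/
def autQuotient (K : Subgroup G) [K.Characteristic] : MulAut G →* MulAut (G ⧸ K) where
  toFun φ := QuotientGroup.congr K K φ (Subgroup.characteristic_iff_map_eq.mp inferInstance φ)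
  map_one' := by
    ext x
    induction x using QuotientGroup.induction_on
    rfl
  map_mul' φ ψ := by
    ext x
    induction x using QuotientGroup.induction_on
    rfl

/-- `I_c A(G)`, the kernel of `π_c : Aut(G) → Aut(G / γ_c(G))`. -/
def IA (c : ℕ+) : Subgroup (MulAut G) := (autQuotient G (gamma ⊤ c)).ker

variable {G}

theorem mem_IA {c : ℕ+} {φ : MulAut G} : φ ∈ IA G c ↔ ∀ x, x⁻¹ * φ x ∈ gamma (⊤ : Subgroup G) c := by
  rw [IA, MonoidHom.mem_ker]
  constructor
  · intro h x
    have h' := DFunLike.congr_fun h (QuotientGroup.mk x)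
    exact QuotientGroup.eq.mp h'.symm
  · intro h
    ext x
    induction x using QuotientGroup.induction_on with
    | H x => exact (QuotientGroup.eq.mpr (h x)).symm

theorem IA_succ_le (c : ℕ+) : IA G (c + 1) ≤ IA G c := fun _ h =>
  mem_IA.mpr fun x => gamma_succ_le _ _ (mem_IA.mp h x)

/-- The holomorph of `G`. -/
abbrev Hol (G : Type*) [Group G] : Type _ := G ⋊[MonoidHom.id (MulAut G)] MulAut G

/-- `γ_c(G)` inside the holomorph. -/
def holGamma (G : Type*) [Group G] (c : ℕ+) : Subgroup (Hol G) := (gamma (⊤ : Subgroup G) c).map SemidirectProduct.inl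

/-- `I_c A(G)` inside the holomorph. -/
def holIA (G : Type*) [Group G] (c : ℕ+) : Subgroup (Hol G) := (IA G c).map SemidirectProduct.inr

instance holGamma_normal (c : ℕ+) : (holGamma G c).Normal := by
  refine ⟨?_⟩
  rintro _ ⟨x, hx, rfl⟩ g
  have hφ : g.right x ∈ gamma (⊤ : Subgroup G) c := by
    have := (gamma_characteristic (G := G) c).fixed g.right
    rw [← this] at hx
    exact hx
  refine ⟨g.left * g.right x * g.left⁻¹,
    (inferInstance : (gamma (⊤ : Subgroup G) c).Normal).conj_mem _ hφ _, ?_⟩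
  apply SemidirectProduct.ext <;> simp

theorem holGamma_succ (c : ℕ+) : holGamma G (c + 1) = ⁅holGamma G c, holGamma G 1⁆ := by
  rw [holGamma, gamma_succ, Subgroup.map_commutator]
  rfl

theorem comm_inr_inl (φ : MulAut G) (x : G) :
    ⁅(SemidirectProduct.inr φ : Hol G), (SemidirectProduct.inl x : Hol G)⁆ =
      SemidirectProduct.inl (φ x * x⁻¹) := by
  apply SemidirectProduct.ext <;> simp [commutatorElement_def]

theorem holIA_commutator_one (c : ℕ+) :
    ⁅holIA G (c + 1), holGamma G 1⁆ ≤ holGamma G (c + 1) := by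
  rw [Subgroup.commutator_le]
  rintro _ ⟨φ, hφ, rfl⟩ _ ⟨x, -, rfl⟩
  rw [comm_inr_inl]
  refine Subgroup.mem_map_of_mem _ ?_
  have h := mem_IA.mp hφ x
  have := (inferInstance : (gamma (⊤ : Subgroup G) (c + 1)).Normal).conj_mem _ h x
  simpa [mul_assoc] using this

theorem holIA_commutator (i j : ℕ+) :
    ⁅holIA G (i + 1), holGamma G j⁆ ≤ holGamma G (i + j) := by
  induction j using PNat.recOn with
  | one => exact holIA_commutator_one i
  | succ j ih =>
    rw [holGamma_succ, Subgroup.commutator_comm (holIA G (i + 1)), ← add_assoc]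
    refine three_subgroups (M := holGamma G (i + j + 1)) ?_ ?_
    · rw [Subgroup.commutator_comm (holGamma G 1)]
      refine (Subgroup.commutator_mono (holIA_commutator_one i) le_rfl).trans ?_
      rw [holGamma, holGamma, holGamma, ← Subgroup.map_commutator]
      refine Subgroup.map_mono ((gamma_top_commutator_le _ _).trans (le_of_eq ?_))
      rw [add_right_comm]
    · rw [holGamma_succ]
      exact Subgroup.commutator_mono ih le_rfl

theorem IA_commutator_le (i j : ℕ+) : ⁅IA G (i + 1), IA G (j + 1)⁆ ≤ IA G (i + j + 1) := by
  have key : ⁅⁅holIA G (i + 1), holIA G (j + 1)⁆, holGamma G 1⁆ ≤ holGamma G (i + j + 1) := by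
    refine three_subgroups (M := holGamma G (i + j + 1)) ?_ ?_
    · rw [Subgroup.commutator_comm]
      refine (Subgroup.commutator_mono le_rfl (holIA_commutator_one j)).trans
        ((holIA_commutator i (j + 1)).trans (le_of_eq ?_))
      rw [add_assoc]
    · rw [Subgroup.commutator_comm (holGamma G 1), Subgroup.commutator_comm]
      refine (Subgroup.commutator_mono le_rfl (holIA_commutator_one i)).trans
        ((holIA_commutator j (i + 1)).trans (le_of_eq ?_))
      rw [← add_assoc, add_comm j i]
  intro φ hφ
  rw [mem_IA]
  intro x
  have h1 : (SemidirectProduct.inr φ : Hol G) ∈ ⁅holIA G (i + 1), holIA G (j + 1)⁆ := by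
    rw [holIA, holIA, ← Subgroup.map_commutator]
    exact Subgroup.mem_map_of_mem _ hφ
  have h2 := key (Subgroup.commutator_mem_commutator h1
    (Subgroup.mem_map_of_mem SemidirectProduct.inl (show x ∈ gamma (⊤ : Subgroup G) 1 from trivial)))
  rw [comm_inr_inl] at h2
  obtain ⟨y, hy, hyx⟩ := h2
  rw [SemidirectProduct.inl_inj] at hyx
  have := (inferInstance : (gamma (⊤ : Subgroup G) (i + j + 1)).Normal).conj_mem _ hy x⁻¹
  rw [hyx] at this
  simpa [mul_assoc] using this

variable (G)

/-- The filtration `IA(G) = I₂A(G) ≥ I₃A(G) ≥ ⋯`; the term of degree `q` is `I_{q+1}A(G)`. -/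
def johnsonSeries : NSeries (MulAut G) where
  sub q := IA G (q + 1)
  succ_le q := IA_succ_le (q + 1)
  commutator_le := IA_commutator_le

/-- The component `𝓛^{q+1}(IA(G)) = I_{q+1}A(G) / I_{q+2}A(G)`, of degree `q`. -/
abbrev johnsonComp (q : ℕ+) : Type _ := (johnsonSeries G).Comp q

/-- The Johnson Lie algebra `𝓛(IA(G)) = ⨁_{r ≥ 2} I_r A(G) / I_{r+1}A(G)`. -/
abbrev johnson : Type _ := (johnsonSeries G).Gr

variable {G}

theorem gamma_le_IA {H : Subgroup (MulAut G)} (hH : H ≤ IA G 2) (q : ℕ+) :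
    gamma H q ≤ IA G (q + 1) := by
  induction q using PNat.recOn with
  | one => exact hH
  | succ q ih =>
    rw [gamma_succ]
    exact (Subgroup.commutator_mono ih hH).trans (IA_commutator_le q 1)

/-- `𝓛₁^q(H) = γ_q(H) I_{q+2}A(G) / I_{q+2}A(G)`, the image of `γ_q(H)` in
`I_{q+1}A(G) / I_{q+2}A(G)`, for a subgroup `H` of `IA(G)`. -/
def L1Comp (H : Subgroup (MulAut G)) (hH : H ≤ IA G 2) (q : ℕ+) :
    AddSubgroup (johnsonComp G q) :=
  ((Subgroup.inclusion (gamma_le_IA hH q)).toAdditive.range).map ((johnsonSeries G).proj q)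

theorem mem_L1Comp {H : Subgroup (MulAut G)} {hH : H ≤ IA G 2} {q : ℕ+} {x : johnsonComp G q} :
    x ∈ L1Comp H hH q ↔ ∃ (a : MulAut G) (ha : a ∈ gamma H q),
      (johnsonSeries G).cl q ⟨a, gamma_le_IA hH q ha⟩ = x := by
  constructor
  · rintro ⟨_, ⟨a, rfl⟩, rfl⟩
    exact ⟨a.toMul.1, a.toMul.2, rfl⟩
  · rintro ⟨a, ha, rfl⟩
    exact ⟨_, ⟨Additive.ofMul ⟨a, ha⟩, rfl⟩, rfl⟩

/-- The Lie subalgebra `𝓛₁(H) = ⨁_q 𝓛₁^q(H)` of the Johnson Lie algebra. -/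
noncomputable def L1 (H : Subgroup (MulAut G)) (hH : H ≤ IA G 2) :
    LieSubalgebra ℤ (johnson G) where
  carrier := {x | ∀ q, (johnsonSeries G).coeff q x ∈ L1Comp H hH q}
  zero_mem' q := by simp
  add_mem' hx hy q := by
    rw [map_add]
    exact add_mem (hx q) (hy q)
  smul_mem' n x hx q := by
    rw [map_zsmul]
    exact zsmul_mem (hx q) n
  lie_mem' {x y} hx hy := by
    classical
    set N := johnsonSeries G
    have hsum : ∀ z : johnson G, z = ∑ i ∈ DFinsupp.support z, N.incl i (N.coeff i z) :=
      fun z => (DirectSum.sum_support_of z).symm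
    intro q
    rw [hsum x, hsum y, sum_lie, map_sum]
    refine sum_mem fun i _ => ?_
    rw [lie_sum, map_sum]
    refine sum_mem fun j _ => ?_
    obtain ⟨a, ha, hax⟩ := mem_L1Comp.mp (hx i)
    obtain ⟨b, hb, hby⟩ := mem_L1Comp.mp (hy j)
    rw [← hax, ← hby, N.lie_cl]
    by_cases hq : q = i + j
    · subst hq
      rw [N.coeff_incl_same]
      exact mem_L1Comp.mpr ⟨comm a b, (lcs H).comm_mem ha hb, rfl⟩
    · rw [N.coeff_incl_of_ne hq]
      exact zero_mem _

/-- A finitely generated subgroup `H` of `IA(G)` with `H / H'` torsion-free is such that `gr(H)` is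
naturally embedded into the Johnson Lie algebra: there is an isomorphism of Lie algebras `φ` from
`gr(H)` onto `𝓛₁(H)` with `φ(y H') = y I₃A(G)` for `y` in `H`. (By additivity it is the same to
ask this for those `y` whose classes form a basis of `H / H'`.) -/
def NaturallyEmbedded (H : Subgroup (MulAut G)) : Prop :=
  ∃ hH : H ≤ IA G 2, H.FG ∧ IsMulTorsionFree (Abelianization H) ∧
    ∃ φ : gr H ≃ₗ⁅ℤ⁆ L1 H hH, ∀ (y : MulAut G) (hy : y ∈ H),
      (φ ((lcs H).incl 1 ((lcs H).cl 1 ⟨y, hy⟩)) : johnson G) =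
        (johnsonSeries G).incl 1 ((johnsonSeries G).cl 1 ⟨y, hH hy⟩)

end Johnson

/-- The group `Inn(G)` of inner automorphisms `τ_g : x ↦ g x g⁻¹`, as a subgroup of `Aut(G)`. -/
def Inn (G : Type*) [Group G] : Subgroup (MulAut G) := MulAut.conj.range

end JohnsonLie

namespace JohnsonLie

open scoped commutatorElement

/-! ### Combinatorics of Lyndon words, ordered lexicographically -/

section Lyndon

variable {α : Type*} [LinearOrder α]

/-! Write F for the free group and H for Inn(F). Since γ_q(H) lies in I_{q+1}A(F), there is a
natural map of graded Lie rings from gr(H) to the Johnson Lie algebra, with image 𝓛₁(H). It is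
injective as soon as γ_q(H) ∩ I_{q+2}A(F) ≤ γ_{q+1}(H) for all q. As γ_q(H) consists of the
conjugations by elements of γ_q(F), this reduces to a statement about F: if g ∈ γ_q(F) and
conjugation by g is trivial modulo γ_{q+2}(F), then g ∈ γ_{q+1}(F)
(`mem_gamma_succ_of_conj_mem_IA`).

In gr(F) the hypothesis says that the class of g commutes with the generators of degree one. The
Magnus expansion a ↦ 1 + aX, followed by taking leading coefficients, maps gr(F) to the free
associative ring and turns brackets into ring commutators. There a series of coefficient comparisons
shows that only constants commute with all generators when there are at least two of them
(`eq_zero_of_commute_gen`), and images of gr(F) have no constant term. So it remains to see that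
gr(F) embeds into the free ring (`leading_magnus_injective`).

The embedding uses Lyndon words. Rewriting by the Jacobi identity shows that the standard
bracketings of Lyndon words span any Lie ring generated by the letters (`lie_lyndonBracket_mem`). In
the free ring the bracketing of w is w plus larger words of the same length
(`wordCoeff_lyndonBracket`), so a nontrivial combination of bracketings cannot map to zero.

Torsion-freeness of H/H' follows from the same two facts: the kernel of F → H lies in γ_2(F), and
F/γ_2(F) embeds into a torsion-free additive group. -/

theorem lt_append_of_ne_nil (u : List α) {v : List α} (hv : v ≠ []) : u < u ++ v := by
  induction u with
  | nil =>
    obtain ⟨a, v, rfl⟩ := List.exists_cons_of_ne_nil hv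
    exact List.nil_lt_cons a v
  | cons a u ih => simpa [List.cons_lt_cons_iff] using ih

theorem append_lt_append_left_iff (u : List α) {v w : List α} : u ++ v < u ++ w ↔ v < w := by
  induction u with
  | nil => rfl
  | cons a u ih => simpa [List.cons_lt_cons_iff] using ih

/-- The comparison is decided at the first letter where the two words differ, so what is appended is
irrelevant. -/
theorem append_lt_append_of_not_prefix {u s : List α} (h : u < s) (hp : ¬ u <+: s)
    (a b : List α) : u ++ a < s ++ b := by
  induction u generalizing s with
  | nil => exact absurd s.nil_prefix hp
  | cons c u ih =>
    cases s with
    | nil => simp at h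
    | cons d s =>
      rw [List.cons_lt_cons_iff] at h
      rw [List.cons_append, List.cons_append, List.cons_lt_cons_iff]
      rcases h with h | ⟨rfl, h⟩
      · exact Or.inl h
      · refine Or.inr ⟨rfl, ih h fun h' => hp ?_⟩
        simpa using h'

/-- A nonempty word is Lyndon if it is smaller than its proper nonempty suffixes. -/
def IsLyndon (w : List α) : Prop :=
  w ≠ [] ∧ ∀ s t, s ++ t = w → s ≠ [] → t ≠ [] → w < t

theorem isLyndon_singleton (a : α) : IsLyndon [a] := by
  refine ⟨by simp, fun s t h hs ht => ?_⟩
  have := congrArg List.length h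
  have := List.length_pos_iff.mpr hs
  have := List.length_pos_iff.mpr ht
  simp only [List.length_append, List.length_singleton] at *
  omega

/-- If v = uz, cancelling u leaves v < z, which is the Lyndon property of v; otherwise u and v
already differ at a letter. -/
theorem append_lt_right {u v : List α} (hv : IsLyndon v) (hu : u ≠ []) (h : u < v) :
    u ++ v < v := by
  by_cases hp : u <+: v
  · obtain ⟨z, rfl⟩ := hp
    rw [append_lt_append_left_iff]
    refine hv.2 u z rfl hu ?_
    rintro rfl
    simp at h
  · simpa using append_lt_append_of_not_prefix h hp v []

theorem IsLyndon.append {u v : List α} (hu : IsLyndon u) (hv : IsLyndon v) (h : u < v) :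
    IsLyndon (u ++ v) := by
  refine ⟨by simp [hu.1], fun s t hst hs ht => ?_⟩
  rcases List.append_eq_append_iff.mp hst with ⟨r, rfl, rfl⟩ | ⟨r, rfl, rfl⟩
  · rcases eq_or_ne r [] with rfl | hr
    · simpa using append_lt_right hv hs (by simpa using h)
    -- The suffix is rv with r a proper suffix of u; u < r, and u is too long to be a prefix of r.
    · refine append_lt_append_of_not_prefix (hu.2 s r rfl hs hr) (fun hp => ?_) v v
      have := hp.length_le
      have := List.length_pos_iff.mpr hs
      simp only [List.length_append] at *
      omega
  · rcases eq_or_ne r [] with rfl | hr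
    · simpa using append_lt_right hv hu.1 h
    · exact (append_lt_right hv hu.1 h).trans (hv.2 r t rfl hr ht)

/-- The standard factorisation of a Lyndon word: `v` is the smallest proper suffix of `u v`. -/
structure IsStd (u v : List α) : Prop where
  left : IsLyndon u
  right : IsLyndon v
  lt : u < v
  le : ∀ s t, s ++ t = u ++ v → s ≠ [] → t ≠ [] → v ≤ t

theorem IsStd.unique {u v u' v' : List α} (h : IsStd u v) (h' : IsStd u' v')
    (e : u ++ v = u' ++ v') : u = u' ∧ v = v' := by
  have hv : v = v' := le_antisymm (h.le u' v' e.symm h'.left.1 h'.right.1)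
    (h'.le u v e h.left.1 h.right.1)
  subst hv
  exact ⟨List.append_cancel_right e, rfl⟩

/-- The right factor v is the smallest proper nonempty suffix. It is Lyndon because its suffixes are
also suffixes of w. The left factor is Lyndon because a suffix t of u = st with t < st would
contradict either stv < tv or the minimality of v. -/
theorem IsLyndon.exists_isStd {w : List α} (hw : IsLyndon w) (hl : 2 ≤ w.length) :
    ∃ u v, u ++ v = w ∧ IsStd u v := by
  have hfin : {t : List α | t ≠ [] ∧ ∃ s, s ≠ [] ∧ s ++ t = w}.Finite := by
    refine (List.finite_toSet w.tails).subset ?_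
    rintro t ⟨-, s, -, rfl⟩
    simp
  have hne : {t : List α | t ≠ [] ∧ ∃ s, s ≠ [] ∧ s ++ t = w}.Nonempty := by
    refine ⟨w.drop 1, ?_, w.take 1, ?_, List.take_append_drop 1 w⟩
    · exact List.ne_nil_of_length_pos (by rw [List.length_drop]; omega)
    · exact List.ne_nil_of_length_pos (by rw [List.length_take]; omega)
  obtain ⟨v, ⟨hv, u, hu, rfl⟩, hmin⟩ := hfin.exists_minimalFor id _ hne
  replace hmin : ∀ s t, s ++ t = u ++ v → s ≠ [] → t ≠ [] → v ≤ t := fun s t h hs ht => by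
    by_contra hlt
    exact hlt (hmin ⟨ht, s, hs, h⟩ (not_le.mp hlt).le)
  refine ⟨u, v, rfl, ⟨hu, fun s t hst hs ht => ?_⟩, ⟨hv, fun s t hst hs ht => ?_⟩, ?_, hmin⟩
  · subst hst
    have h1 : s ++ t ++ v < t ++ v := hw.2 s (t ++ v) (by simp) hs (by simp [hv])
    by_contra hlt
    have hle : t < s ++ t := by
      refine lt_of_le_of_ne (not_lt.mp hlt) fun h => ?_
      have := congrArg List.length h
      have := List.length_pos_iff.mpr hs
      simp only [List.length_append] at *
      omega
    -- If st = tz, cancelling t from stv < tv gives zv < v, although zv is a proper suffix of w.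
    by_cases hp : t <+: s ++ t
    · obtain ⟨z, hz⟩ := hp
      have hz0 : z ≠ [] := by
        rintro rfl
        rw [List.append_nil] at hz
        exact hle.ne hz
      rw [← hz, List.append_assoc, append_lt_append_left_iff] at h1
      exact absurd (hmin t (z ++ v) (by rw [← hz, List.append_assoc]) ht (by simp [hv]))
        (not_le.mpr h1)
    · exact absurd (append_lt_append_of_not_prefix hle hp v v) h1.asymm
  · refine lt_of_le_of_ne (hmin (u ++ s) t (by simp [hst]) (by simp [hu]) ht) ?_
    rintro rfl
    simp at hst
    exact hs hst
  · exact (lt_append_of_ne_nil u hv).trans (hw.2 u v rfl hu hv)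

/-- A proper suffix of uv smaller than v cannot lie inside the Lyndon word v, so it is rv with r a
proper suffix of u. The smallest proper suffix u'' of u then satisfies u'' ≤ r < rv < v. -/
theorem IsLyndon.isStd_or {u v : List α} (hu : IsLyndon u) (hv : IsLyndon v) (h : u < v) :
    IsStd u v ∨ ∃ u' u'', u' ++ u'' = u ∧ IsStd u' u'' ∧ u'' < v := by
  by_cases hs : ∀ s t, s ++ t = u ++ v → s ≠ [] → t ≠ [] → v ≤ t
  · exact Or.inl ⟨hu, hv, h, hs⟩
  · right
    push Not at hs
    obtain ⟨s, t, hst, hs, ht, hlt⟩ := hs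
    rcases List.append_eq_append_iff.mp hst with ⟨r, rfl, rfl⟩ | ⟨r, rfl, rfl⟩
    · have hr : r ≠ [] := by
        rintro rfl
        simp at hlt
      obtain ⟨u', u'', e, hstd⟩ := hu.exists_isStd (by
        have := List.length_pos_iff.mpr hs
        have := List.length_pos_iff.mpr hr
        simp only [List.length_append]
        omega)
      exact ⟨u', u'', e, hstd, (hstd.le s r e.symm hs hr).trans_lt
        ((lt_append_of_ne_nil r hv.1).trans hlt)⟩
    · rcases eq_or_ne r [] with rfl | hr
      · simp at hlt
      · exact absurd (hv.2 r t rfl hr ht) hlt.asymm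

/-! ### Standard bracketings and the Jacobi rewriting -/

variable {L : Type*} [LieRing L]

open Classical in
/-- The standard bracketing of a Lyndon word. -/
noncomputable def lyndonBracket (x : α → L) (w : List α) : L :=
  if h : ∃ p : List α × List α, p.1 ++ p.2 = w ∧ IsStd p.1 p.2 then
    have h1 : h.choose.1.length < w.length := by
      have := congrArg List.length h.choose_spec.1
      have := List.length_pos_iff.mpr h.choose_spec.2.right.1
      rw [List.length_append] at *
      omega
    have h2 : h.choose.2.length < w.length := by
      have := congrArg List.length h.choose_spec.1
      have := List.length_pos_iff.mpr h.choose_spec.2.left.1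
      rw [List.length_append] at *
      omega
    ⁅lyndonBracket x h.choose.1, lyndonBracket x h.choose.2⁆
  -- A single letter has no standard factorisation and gets its generator here; for words that are
  -- not Lyndon the value is junk.
  else (w.head?.map x).getD 0
termination_by w.length

theorem lyndonBracket_append (x : α → L) {u v : List α} (h : IsStd u v) :
    lyndonBracket x (u ++ v) = ⁅lyndonBracket x u, lyndonBracket x v⁆ := by
  have hex : ∃ p : List α × List α, p.1 ++ p.2 = u ++ v ∧ IsStd p.1 p.2 := ⟨(u, v), rfl, h⟩
  obtain ⟨e1, e2⟩ := hex.choose_spec.2.unique h hex.choose_spec.1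
  rw [lyndonBracket, dif_pos hex]
  change ⁅lyndonBracket x hex.choose.1, lyndonBracket x hex.choose.2⁆ = _
  rw [e1, e2]

theorem lyndonBracket_singleton (x : α → L) (a : α) : lyndonBracket x [a] = x a := by
  rw [lyndonBracket, dif_neg]
  · rfl
  · rintro ⟨p, hp, hstd⟩
    have := congrArg List.length hp
    have := List.length_pos_iff.mpr hstd.left.1
    have := List.length_pos_iff.mpr hstd.right.1
    simp only [List.length_append, List.length_singleton] at *
    omega

theorem IsLyndon.induction {p : List α → Prop} (h1 : ∀ a, p [a])
    (h2 : ∀ u v, IsStd u v → p u → p v → p (u ++ v)) {w : List α} (hw : IsLyndon w) : p w := by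
  induction hl : w.length using Nat.strong_induction_on generalizing w with
  | _ m ih =>
    subst hl
    rcases Nat.lt_or_ge w.length 2 with h | h
    · obtain ⟨a, rfl⟩ := List.length_eq_one_iff.mp
        (show w.length = 1 by have := List.length_pos_iff.mpr hw.1; omega)
      exact h1 a
    · obtain ⟨u, v, rfl, hs⟩ := hw.exists_isStd h
      have := List.length_pos_iff.mpr hs.left.1
      have := List.length_pos_iff.mpr hs.right.1
      rw [List.length_append] at ih
      exact h2 u v hs (ih _ (by omega) hs.left rfl) (ih _ (by omega) hs.right rfl)

/-- The span of the standard bracketings of the Lyndon words of length `m` that are smaller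
than `v`. -/
def lyndonSpan (x : α → L) (m : ℕ) (v : List α) : AddSubgroup L :=
  AddSubgroup.closure {y | ∃ w, IsLyndon w ∧ w.length = m ∧ w < v ∧ lyndonBracket x w = y}

theorem lyndonSpan_mono (x : α → L) (m : ℕ) {v v' : List α} (h : v ≤ v') :
    lyndonSpan x m v ≤ lyndonSpan x m v' := by
  refine AddSubgroup.closure_mono ?_
  rintro y ⟨w, h1, h2, h3, rfl⟩
  exact ⟨w, h1, h2, h3.trans_le h, rfl⟩

theorem lie_mem_of_mem_closure {S : Set L} {y z : L} {M : AddSubgroup L}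
    (hy : y ∈ AddSubgroup.closure S) (h : ∀ s ∈ S, ⁅s, z⁆ ∈ M) : ⁅y, z⁆ ∈ M := by
  induction hy using AddSubgroup.closure_induction with
  | mem s hs => exact h s hs
  | zero => simp
  | add a b _ _ ha hb => rw [add_lie]; exact add_mem ha hb
  | neg a _ ha => rw [neg_lie]; exact neg_mem ha

theorem mem_lie_of_mem_closure {S : Set L} {y z : L} {M : AddSubgroup L}
    (hy : y ∈ AddSubgroup.closure S) (h : ∀ s ∈ S, ⁅z, s⁆ ∈ M) : ⁅z, y⁆ ∈ M := by
  rw [← lie_skew]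
  refine neg_mem (lie_mem_of_mem_closure hy fun s hs => ?_)
  rw [← lie_skew]
  exact neg_mem (h s hs)

/-- Induction on the total length m, then on v. If (u, v) is standard, the bracket is that of uv,
and uv < v. Otherwise u = u'u'' with u'' < v, and [[u', u''], v] = [u', [u'', v]] - [u'', [u', v]].
The inner brackets are shorter, hence combinations of Lyndon words below v, and the outer brackets
then involve two words below v. The bound by v in the conclusion is what makes this second induction
work. -/
theorem lie_lyndonBracket_mem [Finite α] (x : α → L) (m : ℕ) :
    ∀ v : List α, v.length ≤ m → IsLyndon v → ∀ u, IsLyndon u → u < v → u.length + v.length = m →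
      ⁅lyndonBracket x u, lyndonBracket x v⁆ ∈ lyndonSpan x m v := by
  induction m using Nat.strong_induction_on with
  | _ m ihm =>
  -- Lexicographic order is not well founded on all words; bounding the length over a finite
  -- alphabet makes it so.
  have : Finite {l : List α // l.length ≤ m} := List.finite_length_le α m
  suffices H : ∀ v : {l : List α // l.length ≤ m}, IsLyndon v.1 → ∀ u, IsLyndon u → u < v.1 →
      u.length + v.1.length = m →
        ⁅lyndonBracket x u, lyndonBracket x v.1⁆ ∈ lyndonSpan x m v.1 from
    fun v hv => H ⟨v, hv⟩
  intro v
  induction v using WellFoundedLT.induction with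
  | _ v ihv =>
  obtain ⟨v, hvm⟩ := v
  intro hv u hu huv hlen
  simp only at hv huv hlen ⊢
  -- The larger of p and q takes the role of v in the inner induction.
  have step : ∀ p q, IsLyndon p → IsLyndon q → p < v → q < v → p.length + q.length = m →
      ⁅lyndonBracket x p, lyndonBracket x q⁆ ∈ lyndonSpan x m v := by
    intro p q hp hq hpv hqv hpq
    rcases lt_trichotomy p q with h | rfl | h
    · exact lyndonSpan_mono x m hqv.le (ihv ⟨q, by omega⟩ hqv hq p hp h hpq)
    · simp
    · rw [← lie_skew]
      exact neg_mem (lyndonSpan_mono x m hpv.le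
        (ihv ⟨p, by omega⟩ hpv hp q hq h (by simp only; omega)))
  rcases hu.isStd_or hv huv with h | ⟨u', u'', rfl, h, huv''⟩
  · refine AddSubgroup.subset_closure ⟨u ++ v, hu.append hv huv, by simpa using hlen,
      append_lt_right hv hu.1 huv, lyndonBracket_append x h⟩
  · have h1 := List.length_pos_iff.mpr h.left.1
    have h2 := List.length_pos_iff.mpr h.right.1
    rw [List.length_append] at hlen
    have huv' : u' < v := h.lt.trans huv''
    rw [lyndonBracket_append x h, lie_lie]
    refine sub_mem ?_ ?_
    · refine mem_lie_of_mem_closure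
        (ihm (u''.length + v.length) (by omega) v (by omega) hv u'' h.right huv'' rfl) ?_
      rintro _ ⟨w, hw, hwl, hwv, rfl⟩
      exact step u' w h.left hw huv' hwv (by omega)
    · refine mem_lie_of_mem_closure
        (ihm (u'.length + v.length) (by omega) v (by omega) hv u' h.left huv' rfl) ?_
      rintro _ ⟨w, hw, hwl, hwv, rfl⟩
      exact step u'' w h.right hw huv'' hwv (by omega)

theorem lie_mem_closure_lyndonBracket [Finite α] (x : α → L) {y z : L}
    (hy : y ∈ AddSubgroup.closure (lyndonBracket x '' {w | IsLyndon w}))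
    (hz : z ∈ AddSubgroup.closure (lyndonBracket x '' {w | IsLyndon w})) :
    ⁅y, z⁆ ∈ AddSubgroup.closure (lyndonBracket x '' {w | IsLyndon w}) := by
  have key : ∀ u v, IsLyndon u → IsLyndon v → u < v → ⁅lyndonBracket x u, lyndonBracket x v⁆ ∈
      AddSubgroup.closure (lyndonBracket x '' {w | IsLyndon w}) := fun u v hu hv h => by
    refine AddSubgroup.closure_mono ?_
      (lie_lyndonBracket_mem x (u.length + v.length) v (by omega) hv u hu h rfl)
    rintro _ ⟨w, hw, -, -, rfl⟩
    exact ⟨w, hw, rfl⟩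
  refine lie_mem_of_mem_closure hy ?_
  rintro _ ⟨u, hu, rfl⟩
  refine mem_lie_of_mem_closure hz ?_
  rintro _ ⟨v, hv, rfl⟩
  rcases lt_trichotomy u v with h | rfl | h
  · exact key u v hu hv h
  · simp
  · rw [← lie_skew]
    exact neg_mem (key v u hv hu h)

end Lyndon

/-! ### The free associative ring and leading words -/

section FreeAlgebra

attribute [local instance] LieRing.ofAssociativeRing

variable {α : Type*}

/-- The free associative ring on `α`. -/
abbrev FreeRing (α : Type*) : Type _ := MonoidAlgebra ℤ (FreeMonoid α)

/-- The coefficient of a word in an element of the free associative ring. -/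
noncomputable def wordCoeff (w : List α) : FreeRing α →+ ℤ where
  toFun f := f.coeff (FreeMonoid.ofList w)
  map_zero' := rfl
  map_add' _ _ := rfl

/-- The generators of the free associative ring. -/
noncomputable def FreeRing.gen (a : α) : FreeRing α := MonoidAlgebra.single (FreeMonoid.of a) 1

theorem FreeRing.ext_wordCoeff {f g : FreeRing α} (h : ∀ w, wordCoeff w f = wordCoeff w g) :
    f = g := by
  rw [← MonoidAlgebra.coeff_inj]
  ext w
  exact h (FreeMonoid.toList w)

theorem wordCoeff_gen [DecidableEq α] (a : α) (w : List α) :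
    wordCoeff w (FreeRing.gen a) = if w = [a] then 1 else 0 := by
  classical
  change (MonoidAlgebra.single (FreeMonoid.of a) (1 : ℤ)).coeff (FreeMonoid.ofList w) = _
  rw [MonoidAlgebra.coeff_single, Finsupp.single_apply]
  refine if_congr ⟨fun h => ?_, fun h => ?_⟩ rfl rfl
  · rw [← FreeMonoid.toList_ofList w, ← h, FreeMonoid.toList_of]
  · rw [h, FreeMonoid.ofList_singleton]

theorem exists_of_wordCoeff_mul_ne_zero {f g : FreeRing α} {w : List α}
    (h : wordCoeff w (f * g) ≠ 0) :
    ∃ u v, u ++ v = w ∧ wordCoeff u f ≠ 0 ∧ wordCoeff v g ≠ 0 := by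
  classical
  change (f * g).coeff (FreeMonoid.ofList w) ≠ 0 at h
  rw [MonoidAlgebra.coeff_mul] at h
  obtain ⟨u, hu, h⟩ := Finset.exists_ne_zero_of_sum_ne_zero h
  obtain ⟨v, hv, h⟩ := Finset.exists_ne_zero_of_sum_ne_zero h
  refine ⟨FreeMonoid.toList u, FreeMonoid.toList v, ?_, Finsupp.mem_support_iff.mp hu,
    Finsupp.mem_support_iff.mp hv⟩
  by_contra hne
  refine h (if_neg fun h' => hne ?_)
  rw [← FreeMonoid.toList_mul, h', FreeMonoid.toList_ofList]

/-- The coefficient of a word in a product is a sum over its factorisations; here only one of them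
contributes. -/
theorem wordCoeff_append_mul {f g : FreeRing α} {u v : List α}
    (h : ∀ s t, s ++ t = u ++ v → wordCoeff s f ≠ 0 → wordCoeff t g ≠ 0 → s = u) :
    wordCoeff (u ++ v) (f * g) = wordCoeff u f * wordCoeff v g := by
  classical
  change (f * g).coeff (FreeMonoid.ofList (u ++ v)) = _
  rw [MonoidAlgebra.coeff_mul, Finsupp.sum, Finset.sum_eq_single (FreeMonoid.ofList u),
    Finsupp.sum, Finset.sum_eq_single (FreeMonoid.ofList v)]
  · exact if_pos rfl
  · intro t _ ht
    refine if_neg fun h' => ht ?_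
    exact mul_left_cancel h'
  · intro hv
    rw [Finsupp.notMem_support_iff.mp hv, mul_zero, ite_self]
  · intro s hs hsu
    refine Finset.sum_eq_zero fun t ht => if_neg fun h' => hsu ?_
    exact h s t h' (Finsupp.mem_support_iff.mp hs) (Finsupp.mem_support_iff.mp ht)
  · intro hu
    refine Finset.sum_eq_zero fun t ht => ?_
    simp only [Finsupp.notMem_support_iff.mp hu, zero_mul, ite_self]

/-- For a word wa choose a letter b ≠ a and compare coefficients of bwa: in b f it is the
coefficient of wa in f, while f b contains only words ending in b. The constant term has to be
excluded because constants are central. -/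
theorem eq_zero_of_commute_gen [Nontrivial α] {f : FreeRing α} (h0 : wordCoeff [] f = 0)
    (h : ∀ a, FreeRing.gen a * f = f * FreeRing.gen a) : f = 0 := by
  classical
  refine FreeRing.ext_wordCoeff fun w => ?_
  rw [map_zero]
  rcases List.eq_nil_or_concat w with rfl | ⟨w, a, rfl⟩
  · exact h0
  · obtain ⟨b, hb⟩ := exists_ne a
    have h1 : wordCoeff ([b] ++ (w ++ [a])) (FreeRing.gen b * f) = wordCoeff (w ++ [a]) f := by
      rw [wordCoeff_append_mul, wordCoeff_gen, if_pos rfl, one_mul]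
      intro s t _ hs _
      rw [wordCoeff_gen] at hs
      by_contra hne
      exact hs (if_neg hne)
    rw [List.concat_eq_append, ← h1, h b]
    by_contra hne
    obtain ⟨s, t, hst, -, ht⟩ := exists_of_wordCoeff_mul_ne_zero hne
    rw [wordCoeff_gen] at ht
    have ht' : t = [b] := by
      by_contra hne
      exact ht (if_neg hne)
    subst ht'
    rw [← List.append_assoc] at hst
    have := (List.append_inj' hst rfl).2
    simp at this
    exact hb this

variable [LinearOrder α]

/-- For w = uv standard, the product of the bracketings of u and v has smallest word uv with
coefficient 1. The opposite product has only words ≥ vu, and uv < v < vu, so it does not disturb the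
leading word. -/
theorem wordCoeff_lyndonBracket {w : List α} (hw : IsLyndon w) :
    wordCoeff w (lyndonBracket FreeRing.gen w) = 1 ∧
      ∀ z, wordCoeff z (lyndonBracket FreeRing.gen w) ≠ 0 → z.length = w.length ∧ w ≤ z := by
  refine IsLyndon.induction (p := fun w => wordCoeff w (lyndonBracket FreeRing.gen w) = 1 ∧
      ∀ z, wordCoeff z (lyndonBracket FreeRing.gen w) ≠ 0 → z.length = w.length ∧ w ≤ z)
    (fun a => ?_) (fun u v h ihu ihv => ?_) hw
  · rw [lyndonBracket_singleton]
    refine ⟨by rw [wordCoeff_gen, if_pos rfl], fun z hz => ?_⟩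
    rw [wordCoeff_gen] at hz
    have : z = [a] := by
      by_contra hne
      exact hz (if_neg hne)
    exact ⟨by rw [this], this.ge⟩
  · rw [lyndonBracket_append _ h, Ring.lie_def]
    have mono : ∀ {s t s' t' : List α}, s.length = s'.length → s ≤ s' → t ≤ t' →
        s ++ t ≤ s' ++ t' := by
      intro s t s' t' hl h1 h2
      rcases h1.eq_or_lt with rfl | h1
      · rcases h2.eq_or_lt with rfl | h2
        · exact le_rfl
        · exact ((append_lt_append_left_iff s).mpr h2).le
      · exact (append_lt_append_of_not_prefix h1 (fun hp => h1.ne (hp.eq_of_length hl)) t t').le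
    have hvu : u ++ v < v ++ u := (append_lt_right h.right h.left.1 h.lt).trans
      (lt_append_of_ne_nil v h.left.1)
    have h2 : ∀ z, wordCoeff z (lyndonBracket FreeRing.gen v * lyndonBracket FreeRing.gen u) ≠ 0 →
        z.length = (u ++ v).length ∧ u ++ v < z := by
      intro z hz
      obtain ⟨s, t, rfl, hs, ht⟩ := exists_of_wordCoeff_mul_ne_zero hz
      obtain ⟨e1, l1⟩ := ihv.2 s hs
      obtain ⟨e2, l2⟩ := ihu.2 t ht
      refine ⟨?_, hvu.trans_le (mono e1.symm l1 l2)⟩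
      simp only [List.length_append]
      omega
    refine ⟨?_, fun z hz => ?_⟩
    · rw [map_sub, wordCoeff_append_mul, ihu.1, ihv.1, sub_eq_self.mpr, mul_one]
      · by_contra hne
        exact (h2 _ hne).2.false
      · intro s t hst hs _
        exact (List.append_inj hst (ihu.2 s hs).1).1
    · rw [map_sub] at hz
      by_cases hz' : wordCoeff z
          (lyndonBracket FreeRing.gen v * lyndonBracket FreeRing.gen u) = 0
      · rw [hz', sub_zero] at hz
        obtain ⟨s, t, rfl, hs, ht⟩ := exists_of_wordCoeff_mul_ne_zero hz
        obtain ⟨e1, l1⟩ := ihu.2 s hs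
        obtain ⟨e2, l2⟩ := ihv.2 t ht
        refine ⟨?_, mono e1.symm l1 l2⟩
        simp only [List.length_append]
        omega
      · exact ⟨(h2 z hz').1, (h2 z hz').2.le⟩

variable {L : Type*} [LieRing L]

theorem map_lyndonBracket {M : Type*} [LieRing M] (f : L →+ M)
    (hf : ∀ y z, f ⁅y, z⁆ = ⁅f y, f z⁆) (x : α → L) {w : List α} (hw : IsLyndon w) :
    f (lyndonBracket x w) = lyndonBracket (fun a => f (x a)) w := by
  refine IsLyndon.induction (p := fun w => f (lyndonBracket x w) =
    lyndonBracket (fun a => f (x a)) w) (fun a => ?_) (fun u v h ihu ihv => ?_) hw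
  · rw [lyndonBracket_singleton, lyndonBracket_singleton]
  · rw [lyndonBracket_append _ h, lyndonBracket_append _ h, hf, ihu, ihv]

/-- A Lie ring generated by a finite family `x` that maps to the free generators of the free
associative ring embeds into the free associative ring. -/
theorem injective_of_map_gen [Finite α] (f : L →+ FreeRing α)
    (hf : ∀ y z, f ⁅y, z⁆ = ⁅f y, f z⁆) (x : α → L) (hx : ∀ a, f (x a) = FreeRing.gen a)
    (hgen : ∀ S : AddSubgroup L, (∀ a, x a ∈ S) → (∀ y ∈ S, ∀ z ∈ S, ⁅y, z⁆ ∈ S) → S = ⊤) :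
    Function.Injective f ∧ ∀ y, wordCoeff [] (f y) = 0 := by
  -- The span of the bracketings contains the generators and is closed under brackets by the
  -- rewriting, so it is all of `L`.
  have htop := hgen (AddSubgroup.closure (lyndonBracket x '' {w | IsLyndon w}))
    (fun a => AddSubgroup.subset_closure ⟨[a], isLyndon_singleton a, lyndonBracket_singleton x a⟩)
    (fun y hy z hz => lie_mem_closure_lyndonBracket x hy hz)
  have hfw : ∀ w, IsLyndon w → f (lyndonBracket x w) = lyndonBracket FreeRing.gen w := by
    intro w hw
    rw [map_lyndonBracket f hf x hw, funext hx]
  refine ⟨(injective_iff_map_eq_zero f).mpr fun y hy => ?_, fun y => ?_⟩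
  · have hmem : y ∈ Submodule.span ℤ (lyndonBracket x '' {w | IsLyndon w}) := by
      rw [← Submodule.mem_toAddSubgroup, Submodule.span_int_eq_addSubgroupClosure, htop]
      trivial
    obtain ⟨c, hc, rfl⟩ := (Finsupp.mem_span_image_iff_linearCombination ℤ).mp hmem
    rcases eq_or_ne c 0 with rfl | hc0
    · simp
    exfalso
    have hne : c.support.Nonempty := Finsupp.support_nonempty_iff.mpr hc0
    -- Every other word v of the support is larger than w, and its bracketing has only words ≥ v, so
    -- the coefficient of w in the image is exactly `c w`.
    set w := c.support.min' hne with hw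
    have hwc : w ∈ c.support := c.support.min'_mem hne
    refine Finsupp.mem_support_iff.mp hwc ?_
    have := congrArg (wordCoeff w) hy
    rw [map_zero, Finsupp.linearCombination_apply, Finsupp.sum, map_sum, map_sum,
      Finset.sum_eq_single w] at this
    · rw [map_zsmul, map_zsmul, hfw w (hc hwc), (wordCoeff_lyndonBracket (hc hwc)).1] at this
      simpa using this
    · intro v hv hvw
      rw [map_zsmul, map_zsmul, hfw v (hc hv)]
      by_contra h
      have h' := (wordCoeff_lyndonBracket (hc hv)).2 w fun h0 => h (by rw [h0, smul_zero])
      exact hvw (le_antisymm h'.2 (c.support.min'_le v hv))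
    · exact fun h => absurd hwc h
  · have hy : y ∈ AddSubgroup.closure (lyndonBracket x '' {w | IsLyndon w}) := htop ▸ trivial
    induction hy using AddSubgroup.closure_induction with
    | mem y hy =>
      obtain ⟨w, hw, rfl⟩ := hy
      rw [hfw w hw]
      by_contra h
      exact hw.1 (List.length_eq_zero_iff.mp ((wordCoeff_lyndonBracket hw).2 [] h).1.symm)
    | zero => simp
    | add y z _ _ h1 h2 => rw [map_add, map_add, h1, h2, add_zero]
    | neg y _ h => rw [map_neg, map_neg, h, neg_zero]

end FreeAlgebra

/-! ### Units of a power series ring; X records the degree -/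

section PowerSeries

open PowerSeries

variable {R : Type*} [Ring R]

/-- Orders add and lowest coefficients multiply. With i or j equal to 0 the corresponding hypothesis
is vacuous. -/
theorem coeff_mul_of_vanish {i j : ℕ} {f g : R⟦X⟧} (hf : ∀ m < i, coeff m f = 0)
    (hg : ∀ m < j, coeff m g = 0) :
    (∀ m < i + j, coeff m (f * g) = 0) ∧ coeff (i + j) (f * g) = coeff i f * coeff j g := by
  constructor
  · intro m hm
    rw [coeff_mul]
    refine Finset.sum_eq_zero fun p hp => ?_
    rw [Finset.HasAntidiagonal.mem_antidiagonal] at hp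
    rcases Nat.lt_or_ge p.1 i with h | h
    · rw [hf _ h, zero_mul]
    · rw [hg p.2 (by omega), mul_zero]
  · rw [coeff_mul, Finset.sum_eq_single (i, j)]
    · intro p hp hne
      rw [Finset.HasAntidiagonal.mem_antidiagonal] at hp
      rcases Nat.lt_or_ge p.1 i with h | h
      · rw [hf _ h, zero_mul]
      · rcases h.eq_or_lt with h | h
        · exact absurd (Prod.ext h.symm (by simp only; omega)) hne
        · rw [hg p.2 (by omega), mul_zero]
    · intro h
      simp at h

theorem one_add_mul_mk_neg_pow (a : R) :
    (1 + C a * X) * PowerSeries.mk (fun k => (-a) ^ k) = 1 := by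
  ext m
  rw [add_mul, one_mul, map_add, coeff_mk, mul_assoc, coeff_C_mul]
  cases m with
  | zero => simp
  | succ m => simp [coeff_succ_X_mul, coeff_one, pow_succ']

theorem mk_neg_pow_mul_one_add (a : R) :
    PowerSeries.mk (fun k => (-a) ^ k) * (1 + C a * X) = 1 := by
  ext m
  rw [mul_add, mul_one, map_add, coeff_mk, ← mul_assoc]
  cases m with
  | zero => simp
  | succ m => simp [coeff_succ_mul_X, coeff_one, pow_succ, coeff_mul_C]

/-- The unit `1 + a X` of the ring of power series. -/
noncomputable def oneAddUnit (a : R) : R⟦X⟧ˣ where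
  val := 1 + C a * X
  inv := PowerSeries.mk fun k => (-a) ^ k
  val_inv := one_add_mul_mk_neg_pow a
  inv_val := mk_neg_pow_mul_one_add a

variable {G : Type*} [Group G] (ρ : G →* R⟦X⟧ˣ)

/-- The elements that a representation by units maps to series congruent to `1` modulo `X ^ q`. -/
def congrOne (q : ℕ) : Subgroup G where
  carrier := {g | ∀ m < q, coeff m ((ρ g : R⟦X⟧) - 1) = 0}
  one_mem' := by simp
  mul_mem' {g h} hg hh m hm := by
    have e : ((ρ (g * h) : R⟦X⟧ˣ) : R⟦X⟧) - 1 =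
        ((ρ g : R⟦X⟧) - 1) * (ρ h : R⟦X⟧) + ((ρ h : R⟦X⟧) - 1) := by
      rw [map_mul, Units.val_mul]
      noncomm_ring
    rw [e, map_add, hh m hm, add_zero]
    exact (coeff_mul_of_vanish hg (g := (ρ h : R⟦X⟧)) (j := 0) (by simp)).1 m (by simpa using hm)
  inv_mem' {g} hg m hm := by
    have e : ((ρ g⁻¹ : R⟦X⟧ˣ) : R⟦X⟧) - 1 = -(((ρ g : R⟦X⟧) - 1) * ((ρ g)⁻¹ : R⟦X⟧ˣ)) := by
      rw [map_inv, sub_mul, Units.mul_inv, one_mul, neg_sub]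
    rw [e, map_neg, neg_eq_zero]
    exact (coeff_mul_of_vanish hg (g := (((ρ g)⁻¹ : R⟦X⟧ˣ) : R⟦X⟧)) (j := 0) (by simp)).1 m
      (by simpa using hm)

/-- From gh = (g - 1)(h - 1) + g + h - 1, where the product has order at least 2q > q. -/
theorem coeff_mul_of_mem_congrOne {q : ℕ} (hq : 0 < q) {g h : G} (hg : g ∈ congrOne ρ q)
    (hh : h ∈ congrOne ρ q) :
    coeff q ((ρ (g * h) : R⟦X⟧ˣ) : R⟦X⟧) =
      coeff q (ρ g : R⟦X⟧) + coeff q (ρ h : R⟦X⟧) := by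
  have e : ((ρ (g * h) : R⟦X⟧ˣ) : R⟦X⟧) =
      ((ρ g : R⟦X⟧) - 1) * ((ρ h : R⟦X⟧) - 1) + (ρ g : R⟦X⟧) + (ρ h : R⟦X⟧) - 1 := by
    rw [map_mul, Units.val_mul]
    noncomm_ring
  rw [e, map_sub, map_add, map_add, (coeff_mul_of_vanish hg hh).1 q (by omega), coeff_one,
    if_neg hq.ne', zero_add, sub_zero]

theorem coeff_eq_zero_of_mem_congrOne {q m : ℕ} (hm : 0 < m) (hmq : m < q) {g : G}
    (hg : g ∈ congrOne ρ q) : coeff m (ρ g : R⟦X⟧) = 0 := by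
  have h := hg m hmq
  rwa [map_sub, coeff_one, if_neg hm.ne', sub_zero] at h

/-- With a = g - 1 and b = h - 1, the commutator minus 1 is (ab - ba)g⁻¹h⁻¹. -/
theorem congrOne_commutator_le (i j : ℕ) :
    ⁅congrOne ρ i, congrOne ρ j⁆ ≤ congrOne ρ (i + j) := by
  rw [Subgroup.commutator_le]
  intro g hg h hh m hm
  have e : ((ρ ⁅g, h⁆ : R⟦X⟧ˣ) : R⟦X⟧) - 1 =
      (((ρ g : R⟦X⟧) - 1) * ((ρ h : R⟦X⟧) - 1) - ((ρ h : R⟦X⟧) - 1) * ((ρ g : R⟦X⟧) - 1)) *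
        ((ρ g)⁻¹ * (ρ h)⁻¹ : R⟦X⟧ˣ) := by
    have e1 : ((ρ g : R⟦X⟧) - 1) * ((ρ h : R⟦X⟧) - 1) - ((ρ h : R⟦X⟧) - 1) * ((ρ g : R⟦X⟧) - 1) =
        ((ρ g * ρ h : R⟦X⟧ˣ) : R⟦X⟧) - ((ρ h * ρ g : R⟦X⟧ˣ) : R⟦X⟧) := by
      rw [Units.val_mul, Units.val_mul]
      noncomm_ring
    rw [e1, sub_mul, ← Units.val_mul, ← Units.val_mul, commutatorElement_def]
    simp [mul_assoc]
  rw [e]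
  refine (coeff_mul_of_vanish (i := i + j) (j := 0) (fun m hm => ?_) (by simp)).1 m
    (by simpa using hm)
  rw [map_sub, (coeff_mul_of_vanish hg hh).1 m hm,
    (coeff_mul_of_vanish hh hg).1 m (by omega), sub_zero]

/-- With a = g - 1 and b = h - 1, hg((g, h) - 1) = ab - ba, and hg has constant term 1, so both
sides have the same coefficient in degree i + j. -/
theorem coeff_comm_of_mem_congrOne {i j : ℕ} (hi : 0 < i) (hj : 0 < j) {g h : G}
    (hg : g ∈ congrOne ρ i) (hh : h ∈ congrOne ρ j) :
    coeff (i + j) (ρ (comm g h) : R⟦X⟧) =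
      coeff i (ρ g : R⟦X⟧) * coeff j (ρ h : R⟦X⟧) -
        coeff j (ρ h : R⟦X⟧) * coeff i (ρ g : R⟦X⟧) := by
  have hc : comm g h ∈ congrOne ρ (i + j) := by
    have h' := congrOne_commutator_le ρ i j
      (Subgroup.commutator_mem_commutator (inv_mem hg) (inv_mem hh))
    simpa [comm, commutatorElement_def] using h'
  have hhg : h * g ∈ congrOne ρ 1 :=
    mul_mem (fun m hm => hh m (by omega)) (fun m hm => hg m (by omega))
  have e : ((ρ (h * g) : R⟦X⟧ˣ) : R⟦X⟧) * ((ρ (comm g h) : R⟦X⟧) - 1) =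
      ((ρ g : R⟦X⟧) - 1) * ((ρ h : R⟦X⟧) - 1) - ((ρ h : R⟦X⟧) - 1) * ((ρ g : R⟦X⟧) - 1) := by
    have e2 : h * g * comm g h = g * h := by simp [comm, mul_assoc]
    rw [mul_sub, mul_one, ← Units.val_mul, ← map_mul, e2, map_mul, map_mul, Units.val_mul,
      Units.val_mul]
    noncomm_ring
  have e0 : coeff 0 ((ρ (h * g) : R⟦X⟧ˣ) : R⟦X⟧) = 1 := by
    have := hhg 0 one_pos
    rwa [map_sub, coeff_one, if_pos rfl, sub_eq_zero] at this
  have key := congrArg (coeff (i + j)) e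
  have h1 := (coeff_mul_of_vanish (f := ((ρ (h * g) : R⟦X⟧ˣ) : R⟦X⟧)) (i := 0) (by simp) hc).2
  rw [zero_add, e0, one_mul] at h1
  have h2 := (coeff_mul_of_vanish hh hg).2
  rw [add_comm j i] at h2
  rw [h1, map_sub, map_sub, (coeff_mul_of_vanish hg hh).2, h2] at key
  simpa only [map_sub, coeff_one, hi.ne', hj.ne', (Nat.add_pos_left hi j).ne', if_false,
    sub_zero] using key

variable {ρ} in
theorem gamma_le_congrOne (hρ : congrOne ρ 1 = ⊤) (q : ℕ+) :
    gamma (⊤ : Subgroup G) q ≤ congrOne ρ q := by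
  induction q using PNat.recOn with
  | one => exact hρ.ge
  | succ q ih =>
    rw [gamma_succ]
    exact (Subgroup.commutator_mono ih hρ.ge).trans (congrOne_commutator_le ρ q 1)

end PowerSeries

/-- The additive map on a component given by a homomorphism on the term of the series. -/
def NSeries.Comp.lift {G M : Type*} [Group G] [AddCommGroup M] (N : NSeries G) (i : ℕ+)
    (f : N.sub i →* Multiplicative M) (h : ∀ a : N.sub i, (a : G) ∈ N.sub (i + 1) → f a = 1) :
    N.Comp i →+ M :=
  MonoidHom.toAdditiveLeft (QuotientGroup.lift ((N.sub (i + 1)).subgroupOf (N.sub i)) f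
    fun a ha => h a (Subgroup.mem_subgroupOf.mp ha))

/-! ### Leading coefficients as a map of Lie rings on gr -/

section Leading

attribute [local instance] LieRing.ofAssociativeRing

open PowerSeries

variable {R : Type*} [Ring R] {G : Type*} [Group G] {ρ : G →* R⟦X⟧ˣ} (hρ : congrOne ρ 1 = ⊤)

/-- The leading coefficient of a representation on a component of the lower central series. -/
noncomputable def leadingComp (q : ℕ+) : grComp (⊤ : Subgroup G) q →+ R :=
  NSeries.Comp.lift (lcs (⊤ : Subgroup G)) q
    (MonoidHom.mk' (fun g => Multiplicative.ofAdd (coeff q (ρ (g : G) : R⟦X⟧))) fun g h =>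
      congrArg Multiplicative.ofAdd (coeff_mul_of_mem_congrOne ρ q.pos
        (gamma_le_congrOne hρ q g.2) (gamma_le_congrOne hρ q h.2)))
    fun g hg => congrArg Multiplicative.ofAdd (coeff_eq_zero_of_mem_congrOne ρ q.pos
      (by simp) (gamma_le_congrOne hρ (q + 1) hg))

/-- The additive map from the associated graded Lie ring given by leading coefficients. -/
noncomputable def leading : gr (⊤ : Subgroup G) →+ R :=
  NSeries.Gr.lift (lcs (⊤ : Subgroup G)) (leadingComp hρ)

theorem leading_incl_cl (q : ℕ+) (g : (lcs (⊤ : Subgroup G)).sub q) :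
    leading hρ ((lcs (⊤ : Subgroup G)).incl q ((lcs (⊤ : Subgroup G)).cl q g)) =
      coeff q (ρ (g : G) : R⟦X⟧) :=
  NSeries.Gr.lift_incl _ _ _ _

theorem leading_lie (x y : gr (⊤ : Subgroup G)) :
    leading hρ ⁅x, y⁆ = ⁅leading hρ x, leading hρ y⁆ := by
  revert x
  refine NSeries.Gr.induction _ (by simp) (fun i a => ?_) (fun x x' h h' => ?_)
  · revert y
    refine NSeries.Gr.induction _ (by simp) (fun j b => ?_) (fun y y' h h' => ?_)
    · rw [NSeries.lie_cl, leading_incl_cl, leading_incl_cl, leading_incl_cl, Ring.lie_def]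
      exact coeff_comm_of_mem_congrOne ρ i.pos j.pos (gamma_le_congrOne hρ i a.2)
        (gamma_le_congrOne hρ j b.2)
    · rw [lie_add, map_add, map_add, lie_add, h, h']
  · rw [add_lie, map_add, map_add, add_lie, h, h']

end Leading

/-- The associated graded Lie ring of the lower central series is generated in degree one. -/
theorem gr_top_generated {G : Type*} [Group G] {X : Set G} (hX : Subgroup.closure X = ⊤)
    (S : AddSubgroup (gr (⊤ : Subgroup G)))
    (h1 : ∀ a ∈ X, (lcs (⊤ : Subgroup G)).incl 1 ((lcs (⊤ : Subgroup G)).cl 1 ⟨a, trivial⟩) ∈ S)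
    (h2 : ∀ y ∈ S, ∀ z ∈ S, ⁅y, z⁆ ∈ S) : S = ⊤ := by
  set N := lcs (⊤ : Subgroup G)
  have hone : ∀ a : N.sub 1, N.incl 1 (N.cl 1 a) ∈ S := by
    rintro ⟨a, ha⟩
    have hmem : a ∈ Subgroup.closure X := hX ▸ trivial
    induction hmem using Subgroup.closure_induction with
    | mem a h => exact h1 a h
    | one =>
      have : N.incl 1 (N.cl 1 ⟨1, ha⟩) = 0 := map_zero (N.incl 1)
      rw [this]
      exact zero_mem S
    | mul a b _ _ iha ihb =>
      have : N.incl 1 (N.cl 1 ⟨a * b, ha⟩) =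
          N.incl 1 (N.cl 1 ⟨a, trivial⟩) + N.incl 1 (N.cl 1 ⟨b, trivial⟩) :=
        map_add (N.incl 1) (N.cl 1 ⟨a, trivial⟩) (N.cl 1 ⟨b, trivial⟩)
      rw [this]
      exact add_mem (iha trivial) (ihb trivial)
    | inv a _ iha =>
      have : N.incl 1 (N.cl 1 ⟨a⁻¹, ha⟩) = -N.incl 1 (N.cl 1 ⟨a, trivial⟩) :=
        map_neg (N.incl 1) (N.cl 1 ⟨a, trivial⟩)
      rw [this]
      exact neg_mem (iha trivial)
  have hall : ∀ (q : ℕ+) (a : N.sub q), N.incl q (N.cl q a) ∈ S := by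
    intro q
    induction q using PNat.recOn with
    | one => exact hone
    | succ q ih =>
      rintro ⟨a, ha⟩
      have hmem : a ∈ Subgroup.closure
          {g | ∃ b ∈ gamma (⊤ : Subgroup G) q, ∃ c ∈ (⊤ : Subgroup G), ⁅b, c⁆ = g} := by
        have h : a ∈ gamma (⊤ : Subgroup G) (q + 1) := ha
        rwa [gamma_succ, Subgroup.commutator_def] at h
      have hle : ∀ x ∈ Subgroup.closure
          {g | ∃ b ∈ gamma (⊤ : Subgroup G) q, ∃ c ∈ (⊤ : Subgroup G), ⁅b, c⁆ = g},
          x ∈ N.sub (q + 1) := by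
        intro x hx
        change x ∈ gamma (⊤ : Subgroup G) (q + 1)
        rwa [gamma_succ, Subgroup.commutator_def]
      induction hmem using Subgroup.closure_induction with
      | mem a h =>
        obtain ⟨b, hb, c, hc, rfl⟩ := h
        -- The inverses translate between the conventions bcb⁻¹c⁻¹ and b⁻¹c⁻¹bc.
        have e : N.incl (q + 1) (N.cl (q + 1) ⟨⁅b, c⁆, ha⟩) =
            ⁅N.incl q (N.cl q ⟨b⁻¹, inv_mem hb⟩), N.incl 1 (N.cl 1 ⟨c⁻¹, trivial⟩)⁆ := by
          rw [N.lie_cl]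
          congr 2
          exact Subtype.ext (by simp [NSeries.commEl, comm, commutatorElement_def])
        rw [e]
        exact h2 _ (ih _) _ (hone _)
      | one =>
        have : N.incl (q + 1) (N.cl (q + 1) ⟨1, ha⟩) = 0 := map_zero (N.incl (q + 1))
        rw [this]
        exact zero_mem S
      | mul a b h h' iha ihb =>
        have : N.incl (q + 1) (N.cl (q + 1) ⟨a * b, ha⟩) =
            N.incl (q + 1) (N.cl (q + 1) ⟨a, hle a h⟩) +
              N.incl (q + 1) (N.cl (q + 1) ⟨b, hle b h'⟩) :=
          map_add (N.incl (q + 1)) (N.cl (q + 1) ⟨a, hle a h⟩) (N.cl (q + 1) ⟨b, hle b h'⟩)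
        rw [this]
        exact add_mem (iha _) (ihb _)
      | inv a h iha =>
        have : N.incl (q + 1) (N.cl (q + 1) ⟨a⁻¹, ha⟩) =
            -N.incl (q + 1) (N.cl (q + 1) ⟨a, hle a h⟩) :=
          map_neg (N.incl (q + 1)) (N.cl (q + 1) ⟨a, hle a h⟩)
        rw [this]
        exact neg_mem (iha _)
  refine eq_top_iff.mpr fun x _ => ?_
  exact NSeries.Gr.induction N (p := fun x => x ∈ S) (zero_mem S) hall (fun _ _ => add_mem) x

/-! ### The Magnus embedding of gr of a free group -/

section Magnus

attribute [local instance] LieRing.ofAssociativeRing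

variable {α : Type*}

/-- The Magnus representation of a free group by units of a ring of power series. -/
noncomputable def magnus (α : Type*) : FreeGroup α →* (PowerSeries (FreeRing α))ˣ :=
  FreeGroup.lift fun a => oneAddUnit (FreeRing.gen a)

theorem magnus_of (a : α) : ((magnus α (FreeGroup.of a) : (PowerSeries (FreeRing α))ˣ) :
    PowerSeries (FreeRing α)) = 1 + PowerSeries.C (FreeRing.gen a) * PowerSeries.X := by
  rw [magnus, FreeGroup.lift_apply_of]
  rfl

theorem congrOne_magnus_one : congrOne (magnus α) 1 = ⊤ := by
  rw [eq_top_iff, ← FreeGroup.closure_range_of, Subgroup.closure_le]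
  rintro _ ⟨a, rfl⟩ m hm
  obtain rfl : m = 0 := by omega
  rw [magnus_of, add_sub_cancel_left]
  simp

theorem leading_magnus_of (a : α) :
    leading (congrOne_magnus_one (α := α)) ((lcs (⊤ : Subgroup (FreeGroup α))).incl 1
      ((lcs (⊤ : Subgroup (FreeGroup α))).cl 1 ⟨FreeGroup.of a, trivial⟩)) = FreeRing.gen a := by
  rw [leading_incl_cl, PNat.one_coe, magnus_of]
  simp [PowerSeries.coeff_one]

/-- The associated graded Lie ring of a free group of finite rank embeds into the free associative
ring. -/
theorem leading_magnus_injective [LinearOrder α] [Finite α] :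
    Function.Injective (leading (congrOne_magnus_one (α := α))) ∧
      ∀ y, wordCoeff [] (leading (congrOne_magnus_one (α := α)) y) = 0 := by
  refine injective_of_map_gen _ (leading_lie _) _ leading_magnus_of fun S h1 h2 => ?_
  refine gr_top_generated (FreeGroup.closure_range_of α) S ?_ h2
  rintro _ ⟨a, rfl⟩
  exact h1 a

theorem NSeries.cl_eq_zero_iff {G : Type*} [Group G] (N : NSeries G) {q : ℕ+} {a : N.sub q} :
    N.cl q a = 0 ↔ (a : G) ∈ N.sub (q + 1) := by
  rw [← N.cl_one, eq_comm, N.cl_eq_iff]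
  simp

theorem NSeries.incl_injective {G : Type*} [Group G] (N : NSeries G) (q : ℕ+) :
    Function.Injective (N.incl q) :=
  Function.LeftInverse.injective (g := N.coeff q) (N.coeff_incl_same q)

/-- An element of `γ_q` of a free group that is central modulo `γ_{q+2}` lies in `γ_{q+1}`. -/
theorem mem_gamma_succ_of_conj_mem_IA [LinearOrder α] [Finite α] [Nontrivial α] {q : ℕ+}
    {g : FreeGroup α} (hg : g ∈ gamma (⊤ : Subgroup (FreeGroup α)) q)
    (h : MulAut.conj g ∈ IA (FreeGroup α) (q + 1 + 1)) :
    g ∈ gamma (⊤ : Subgroup (FreeGroup α)) (q + 1) := by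
  set N := lcs (⊤ : Subgroup (FreeGroup α))
  obtain ⟨hinj, hnil⟩ := leading_magnus_injective (α := α)
  refine (N.cl_eq_zero_iff (a := ⟨g, hg⟩)).mp (N.incl_injective q (hinj ?_))
  rw [map_zero, map_zero]
  refine eq_zero_of_commute_gen (hnil _) fun a => ?_
  have hzero : ⁅N.incl q (N.cl q ⟨g, hg⟩), N.incl 1 (N.cl 1 ⟨FreeGroup.of a, trivial⟩)⁆ = 0 := by
    rw [N.lie_cl, N.cl_eq_zero_iff.mpr, map_zero]
    change comm g (FreeGroup.of a) ∈ gamma ⊤ (q + 1 + 1)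
    have h1 := mem_IA.mp h (FreeGroup.of a)
    -- Conjugating x⁻¹(g x g⁻¹) by g⁻¹ turns it into (g, x) = g⁻¹x⁻¹gx.
    have h2 := (inferInstance : (gamma (⊤ : Subgroup (FreeGroup α)) (q + 1 + 1)).Normal).conj_mem
      _ h1 g⁻¹
    simpa [comm, mul_assoc, MulAut.conj_apply] using h2
  have hcomm := leading_lie (congrOne_magnus_one (α := α)) (N.incl q (N.cl q ⟨g, hg⟩))
    (N.incl 1 (N.cl 1 ⟨FreeGroup.of a, trivial⟩))
  rw [hzero, map_zero, leading_magnus_of, Ring.lie_def] at hcomm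
  exact (sub_eq_zero.mp hcomm.symm).symm

/-- The degree-one part of gr embeds into the free ring, whose coefficients are integers and hence
torsion-free. -/
theorem mem_gamma_two_of_pow_mem [LinearOrder α] [Finite α] {m : ℕ} (hm : m ≠ 0) {g : FreeGroup α}
    (h : g ^ m ∈ gamma (⊤ : Subgroup (FreeGroup α)) (1 + 1)) :
    g ∈ gamma (⊤ : Subgroup (FreeGroup α)) (1 + 1) := by
  set N := lcs (⊤ : Subgroup (FreeGroup α))
  refine (N.cl_eq_zero_iff (q := 1) (a := ⟨g, trivial⟩)).mp
    (N.incl_injective 1 ((leading_magnus_injective (α := α)).1 ?_))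
  have hpow : m • N.incl 1 (N.cl 1 ⟨g, trivial⟩) = 0 := by
    have e : N.incl 1 (N.cl 1 (⟨g, trivial⟩ ^ m)) = m • N.incl 1 (N.cl 1 ⟨g, trivial⟩) :=
      map_nsmul ((N.incl 1).comp (N.proj 1)) m (Additive.ofMul ⟨g, trivial⟩)
    have h0 : N.cl 1 (⟨g, trivial⟩ ^ m) = 0 := N.cl_eq_zero_iff.mpr h
    rw [← e, h0, map_zero]
  have h' := congrArg (leading (congrOne_magnus_one (α := α))) hpow
  rw [map_nsmul, map_zero] at h'
  rw [map_zero, map_zero]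
  refine FreeRing.ext_wordCoeff fun w => ?_
  have hw := congrArg (wordCoeff w) h'
  rw [map_nsmul, map_zero, smul_eq_zero] at hw
  rw [map_zero]
  exact hw.resolve_left hm

end Magnus

/-! ### The natural map from gr(H) to the Johnson Lie algebra -/

section Embedding

variable {G : Type*} [Group G] {H : Subgroup (MulAut G)}

section

variable (hH : H ≤ IA G 2)

/-- The natural map from `gr_q(H)` to the Johnson Lie algebra. -/
def toJohnsonComp (q : ℕ+) : grComp H q →+ johnsonComp G q :=
  NSeries.Comp.lift (lcs H) q
    ((AddMonoidHom.toMultiplicativeRight ((johnsonSeries G).proj q)).comp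
      (Subgroup.inclusion (gamma_le_IA hH q)))
    fun a ha => congrArg Multiplicative.ofAdd ((johnsonSeries G).cl_eq_zero_iff
      (a := Subgroup.inclusion (gamma_le_IA hH q) a) |>.mpr (gamma_le_IA hH (q + 1) ha))

theorem toJohnsonComp_cl (q : ℕ+) (a : (lcs H).sub q) :
    toJohnsonComp hH q ((lcs H).cl q a) =
      (johnsonSeries G).cl q ⟨a, gamma_le_IA hH q a.2⟩ := rfl

theorem toJohnsonComp_mem (q : ℕ+) (x : grComp H q) : toJohnsonComp hH q x ∈ L1Comp H hH q := by
  obtain ⟨a, rfl⟩ := (lcs H).cl_surjective q x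
  exact mem_L1Comp.mpr ⟨a, a.2, rfl⟩

/-- The hypothesis is the inclusion γ_q(H) ∩ I_{q+2}A(G) ≤ γ_{q+1}(H), that is, triviality of the
kernel in degree q. -/
theorem toJohnsonComp_injective
    (hinj : ∀ (q : ℕ+), ∀ a ∈ gamma H q, a ∈ IA G (q + 1 + 1) → a ∈ gamma H (q + 1)) (q : ℕ+) :
    Function.Injective (toJohnsonComp hH q) := by
  rw [injective_iff_map_eq_zero]
  intro x hx
  obtain ⟨a, rfl⟩ := (lcs H).cl_surjective q x
  rw [toJohnsonComp_cl, NSeries.cl_eq_zero_iff] at hx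
  exact (lcs H).cl_eq_zero_iff.mpr (hinj q a a.2 hx)

/-- The natural map from `gr(H)` to the Johnson Lie algebra. -/
noncomputable def toJohnson : gr H →+ johnson G :=
  NSeries.Gr.lift (lcs H) fun q => ((johnsonSeries G).incl q).comp (toJohnsonComp hH q)

theorem toJohnson_incl (q : ℕ+) (x : grComp H q) :
    toJohnson hH ((lcs H).incl q x) = (johnsonSeries G).incl q (toJohnsonComp hH q x) :=
  NSeries.Gr.lift_incl _ _ _ _

theorem coeff_toJohnson (q : ℕ+) (x : gr H) :
    (johnsonSeries G).coeff q (toJohnson hH x) = toJohnsonComp hH q ((lcs H).coeff q x) := by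
  revert x
  refine NSeries.Gr.induction _ (by simp) (fun i a => ?_) (fun x y hx hy => ?_)
  · rw [toJohnson_incl]
    by_cases h : q = i
    · subst h
      rw [NSeries.coeff_incl_same, NSeries.coeff_incl_same]
    · rw [NSeries.coeff_incl_of_ne _ h, NSeries.coeff_incl_of_ne _ h, map_zero]
  · simp only [map_add, hx, hy]

theorem toJohnson_lie (x y : gr H) : toJohnson hH ⁅x, y⁆ = ⁅toJohnson hH x, toJohnson hH y⁆ := by
  revert x
  refine NSeries.Gr.induction _ (by simp) (fun i a => ?_) (fun x x' h h' => ?_)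
  · revert y
    refine NSeries.Gr.induction _ (by simp) (fun j b => ?_) (fun y y' h h' => ?_)
    · rw [NSeries.lie_cl, toJohnson_incl, toJohnson_incl, toJohnson_incl, toJohnsonComp_cl,
        toJohnsonComp_cl, toJohnsonComp_cl, NSeries.lie_cl]
      rfl
    · rw [lie_add, map_add, map_add, lie_add, h, h']
  · rw [add_lie, map_add, map_add, add_lie, h, h']

theorem NSeries.Gr.eq_zero_of_coeff {G : Type*} [Group G] (N : NSeries G) {x : N.Gr}
    (h : ∀ q, N.coeff q x = 0) : x = 0 := DFinsupp.ext h

/-- Each of the finitely many nonzero components has a representative in γ_i(H), which lifts it. -/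
theorem mem_range_toJohnson {z : johnson G} (hz : z ∈ L1 H hH) : z ∈ (toJohnson hH).range := by
  classical
  have hsum : z = ∑ i ∈ DFinsupp.support z,
      (johnsonSeries G).incl i ((johnsonSeries G).coeff i z) := (DirectSum.sum_support_of z).symm
  rw [hsum]
  refine sum_mem fun i _ => ?_
  obtain ⟨a, ha, hax⟩ := mem_L1Comp.mp (hz i)
  exact ⟨(lcs H).incl i ((lcs H).cl i ⟨a, ha⟩), by rw [toJohnson_incl, toJohnsonComp_cl, ← hax]⟩

/-- The natural map from `gr(H)` to `𝓛₁(H)`, a homomorphism of Lie algebras. -/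
noncomputable def toL1 : gr H →ₗ⁅ℤ⁆ L1 H hH where
  toFun x := ⟨toJohnson hH x, fun q => by
    rw [coeff_toJohnson]
    exact toJohnsonComp_mem hH q _⟩
  map_add' x y := Subtype.ext (map_add (toJohnson hH) x y)
  map_smul' m x := Subtype.ext (map_zsmul (toJohnson hH) m x)
  map_lie' {x y} := Subtype.ext (toJohnson_lie hH x y)

theorem toL1_bijective
    (hinj : ∀ (q : ℕ+), ∀ a ∈ gamma H q, a ∈ IA G (q + 1 + 1) → a ∈ gamma H (q + 1)) :
    Function.Bijective (toL1 hH) := by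
  constructor
  · refine (injective_iff_map_eq_zero (toL1 hH)).mpr fun x hx => ?_
    have hx' : toJohnson hH x = 0 := congrArg Subtype.val hx
    refine NSeries.Gr.eq_zero_of_coeff _ fun q => toJohnsonComp_injective hH hinj q ?_
    rw [← coeff_toJohnson, hx', map_zero, map_zero]
  · rintro ⟨z, hz⟩
    obtain ⟨x, rfl⟩ := mem_range_toJohnson hH hz
    exact ⟨x, rfl⟩

end

theorem naturallyEmbedded_of_injective (hH : H ≤ IA G 2) (hfg : H.FG)
    (htf : IsMulTorsionFree (Abelianization H))
    (hinj : ∀ (q : ℕ+), ∀ a ∈ gamma H q, a ∈ IA G (q + 1 + 1) → a ∈ gamma H (q + 1)) :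
    NaturallyEmbedded H :=
  ⟨hH, hfg, htf, LieEquiv.ofBijective (toL1 hH) (toL1_bijective hH hinj),
    fun y hy => toJohnson_incl hH 1 ((lcs H).cl 1 ⟨y, hy⟩)⟩

theorem exists_submodule_equiv_grComp (hH : H ≤ IA G 2)
    (hinj : ∀ (q : ℕ+), ∀ a ∈ gamma H q, a ∈ IA G (q + 1 + 1) → a ∈ gamma H (q + 1)) (q : ℕ+) :
    ∃ S : Submodule ℤ (johnsonComp G q), Nonempty (grComp H q ≃ₗ[ℤ] S) :=
  ⟨_, ⟨LinearEquiv.ofInjective (toJohnsonComp hH q).toIntLinearMap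
    (toJohnsonComp_injective hH hinj q)⟩⟩

end Embedding

/-! ### Inner automorphisms and abelianizations -/

section Inner

variable {G : Type*} [Group G]

/-- Homomorphisms carry lower central series to those of the image; this moves questions about `Inn
G` back to `G`. -/
theorem gamma_Inn (q : ℕ+) : gamma (Inn G) q = (gamma (⊤ : Subgroup G) q).map MulAut.conj := by
  rw [gamma, gamma, Subgroup.map_lowerCentralSeries, ← MonoidHom.range_eq_map]
  rfl

theorem Inn_le_IA_two : Inn G ≤ IA G 2 := by
  rintro _ ⟨g, rfl⟩
  refine mem_IA.mpr fun x => ?_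
  change _ ∈ gamma (⊤ : Subgroup G) (1 + 1)
  rw [gamma_succ]
  have h := Subgroup.commutator_mem_commutator (show x⁻¹ ∈ gamma (⊤ : Subgroup G) 1 from trivial)
    (show g ∈ (⊤ : Subgroup G) from trivial)
  simpa [commutatorElement_def, mul_assoc, MulAut.conj_apply] using h

theorem isMulTorsionFree_abelianization_of_pow {K : Type*} [Group K]
    (h : ∀ (m : ℕ) (a : K), m ≠ 0 → a ^ m ∈ commutator K → a ∈ commutator K) :
    IsMulTorsionFree (Abelianization K) := by
  refine ⟨fun m hm x y hxy => ?_⟩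
  rw [← div_eq_one]
  have hxy' : (x / y) ^ m = 1 := by rw [div_pow, div_eq_one]; exact hxy
  obtain ⟨a, ha⟩ := QuotientGroup.mk_surjective (s := commutator K) (x / y)
  change Abelianization.of a = x / y at ha
  rw [← ha] at hxy' ⊢
  rw [← map_pow, ← MonoidHom.mem_ker, Abelianization.ker_of] at hxy'
  rw [← MonoidHom.mem_ker, Abelianization.ker_of]
  exact h m a hm hxy'

theorem mem_commutator_iff_mem_gamma_two {S : Subgroup G} {a : S} :
    a ∈ commutator S ↔ (a : G) ∈ gamma S (1 + 1) := by
  rw [← map_subtype_gamma_top, gamma_succ, gamma_one, ← commutator_def]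
  simp

end Inner

/-! ### Inner automorphisms of free groups -/

section FreeGroup

variable {α : Type*} [LinearOrder α] [Finite α] [Nontrivial α]

theorem mem_gamma_Inn_succ (q : ℕ+) (a : MulAut (FreeGroup α))
    (ha : a ∈ gamma (Inn (FreeGroup α)) q) (h : a ∈ IA (FreeGroup α) (q + 1 + 1)) :
    a ∈ gamma (Inn (FreeGroup α)) (q + 1) := by
  rw [gamma_Inn] at ha ⊢
  obtain ⟨g, hg, rfl⟩ := ha
  exact Subgroup.mem_map_of_mem _ (mem_gamma_succ_of_conj_mem_IA hg h)

/-- If conjugation by g^m lies in γ_2 of the inner automorphisms, then g^m differs from some c ∈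
γ_2(F) by an element of the kernel of conjugation. That kernel lies in γ_2(F), so g^m and then g lie
in γ_2(F). -/
theorem isMulTorsionFree_abelianization_Inn :
    IsMulTorsionFree (Abelianization (Inn (FreeGroup α))) := by
  refine isMulTorsionFree_abelianization_of_pow ?_
  rintro m ⟨_, g, rfl⟩ hm h
  rw [mem_commutator_iff_mem_gamma_two, gamma_Inn] at h ⊢
  obtain ⟨c, hc, hcg⟩ := h
  have hcg' : MulAut.conj (g ^ m * c⁻¹) = 1 := by
    rw [map_mul, map_inv, hcg, map_pow]
    simp
  -- Case q = 1 of the centrality lemma: every element is in γ_1, and the identity automorphism is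
  -- in I_3A.
  have hz : g ^ m * c⁻¹ ∈ gamma (⊤ : Subgroup (FreeGroup α)) (1 + 1) :=
    mem_gamma_succ_of_conj_mem_IA trivial (hcg' ▸ one_mem _)
  have hgm := mul_mem hz hc
  rw [inv_mul_cancel_right] at hgm
  exact Subgroup.mem_map_of_mem _ (mem_gamma_two_of_pow_mem hm hgm)

theorem Inn_fg (α : Type*) [Finite α] : (Inn (FreeGroup α)).FG :=
  (Group.fg_iff_subgroup_fg _).mp
    (inferInstanceAs (Group.FG (MulAut.conj (G := FreeGroup α)).range))

end FreeGroup

end JohnsonLie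

theorem mainTheorem5 (n : ℕ) (hn : 2 ≤ n) :
    JohnsonLie.NaturallyEmbedded (JohnsonLie.Inn (FreeGroup (Fin n))) ∧
      ∀ c : ℕ+, ∃ S : Submodule ℤ (JohnsonLie.johnsonComp (FreeGroup (Fin n)) c),
        Nonempty (JohnsonLie.grComp (JohnsonLie.Inn (FreeGroup (Fin n))) c ≃ₗ[ℤ] S) := by
  -- Two distinct letters are what `eq_zero_of_commute_gen` needs.
  have : Nontrivial (Fin n) := Fin.nontrivial_iff_two_le.mpr hn
  exact ⟨JohnsonLie.naturallyEmbedded_of_injective JohnsonLie.Inn_le_IA_two (JohnsonLie.Inn_fg _)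
      JohnsonLie.isMulTorsionFree_abelianization_Inn JohnsonLie.mem_gamma_Inn_succ,
    JohnsonLie.exists_submodule_equiv_grComp JohnsonLie.Inn_le_IA_two
      JohnsonLie.mem_gamma_Inn_succ⟩
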